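/- Let $N\ge 1$, let $\Omega\subset\mathbb R^N$ be bounded and open, let $\beta>0$, and let $f\in L^1(\Omega)$ with $f\ge 0$ a.e. in $\Omega$. Let $u\in H^1_{loc}(\Omega)$ be a weak solution of $$-\Delta u=\frac{f}{u^\beta},\qquad u>0\quad\text{in }\Omega,\qquad u=0\quad\text{on }\partial\Omega .$$ Here the equation means that $\int_\Omega\nabla u\cdot\nabla\varphi\,dx=\int_\Omega \frac{f}{u^\beta}\,\varphi\,dx$ for all $\varphi\in C^1_c(\Omega)$; $u>0$ in $\Omega$ means that $\operatorname{ess\,inf}_K u>0$ for every compact $K\subset\Omega$; and $u=0$ on $\partial\Omega$ means that $u\ge0$ a.e. in $\Omega$ and $(u-\varepsilon)^+\in H^1_0(\Omega)$ for every $\varepsilon>0$. Then the following hold. 1. $u$ is the only such solution: any other one coincides with $u$ a.e. in $\Omega$. 2. Let $\nu\in S^{N-1}$, $\lambda\in\mathbb R$, and let $\sigma(x)=x-2(x\cdot\nu-\lambda)\nu$ be the reflection in the hyperplane $\{x\cdot\nu=\lambda\}$. If $\sigma(\Omega)=\Omega$ and $f\circ\sigma=f$ a.e. in $\Omega$, then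 $u\circ\sigma=u$ a.e. in $\Omega$. 3. In particular, if $\Omega$ is invariant under $(x_1,x')\mapsto(-x_1,x')$ and $f(x_1,x')=f(-x_1,x')$ for a.e. $(x_1,x')\in\Omega$, then $u(x_1,x')=u(-x_1,x')$ for a.e. $(x_1,x')\in\Omega$. 4. If $\Omega$ is a ball $\{|x|<R\}$ with $R>0$, or an annulus $\{r<|x|<R\}$ with $0<r<R$, and $f$ is radial (that is, $f$ coincides a.e. in $\Omega$ with a function of $|x|$), then $u$ is radial. -/

import Mathlib

open MeasureTheory Filter Topology

/-- Functions of class `C^k` with compact support contained in the open set `Ω`. -/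
def IsTestFunction {N : ℕ} (k : ℕ∞) (Ω : Set (EuclideanSpace ℝ (Fin N)))
    (φ : EuclideanSpace ℝ (Fin N) → ℝ) : Prop :=
  ContDiff ℝ (k : WithTop ℕ∞) φ ∧ HasCompactSupport φ ∧ tsupport φ ⊆ Ω

/-- `w ∈ L²_loc(Ω)`: `w` is square integrable on every compact subset of `Ω`. -/
def MemL2Loc {N : ℕ} {F : Type*} [NormedAddCommGroup F] (Ω : Set (EuclideanSpace ℝ (Fin N)))
    (w : EuclideanSpace ℝ (Fin N) → F) : Prop :=
  ∀ K : Set (EuclideanSpace ℝ (Fin N)), IsCompact K → K ⊆ Ω → MemLp w 2 (volume.restrict K)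

/-- `G` is the distributional (weak) gradient of `w` in `Ω`. -/
def HasWeakGradient {N : ℕ} (Ω : Set (EuclideanSpace ℝ (Fin N)))
    (w : EuclideanSpace ℝ (Fin N) → ℝ)
    (G : EuclideanSpace ℝ (Fin N) → EuclideanSpace ℝ (Fin N)) : Prop :=
  LocallyIntegrableOn w Ω volume ∧ LocallyIntegrableOn G Ω volume ∧
  ∀ φ : EuclideanSpace ℝ (Fin N) → ℝ, IsTestFunction ⊤ Ω φ →
    ∀ i : Fin N, ∫ x in Ω, w x * gradient φ x i = - ∫ x in Ω, G x i * φ x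

/-- `w ∈ H¹_loc(Ω)`, with weak gradient `G`. -/
def MemH1Loc {N : ℕ} (Ω : Set (EuclideanSpace ℝ (Fin N)))
    (w : EuclideanSpace ℝ (Fin N) → ℝ)
    (G : EuclideanSpace ℝ (Fin N) → EuclideanSpace ℝ (Fin N)) : Prop :=
  HasWeakGradient Ω w G ∧ MemL2Loc Ω w ∧ MemL2Loc Ω G

/-- `w ∈ H¹₀(Ω)`: `w` belongs to `H¹(Ω)` and is the limit, in the norm of `H¹(Ω)`, of a sequence
of functions in `C_c^∞(Ω)`. -/
def MemH10 {N : ℕ} (Ω : Set (EuclideanSpace ℝ (Fin N)))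
    (w : EuclideanSpace ℝ (Fin N) → ℝ) : Prop :=
  ∃ G : EuclideanSpace ℝ (Fin N) → EuclideanSpace ℝ (Fin N),
    HasWeakGradient Ω w G ∧ MemLp w 2 (volume.restrict Ω) ∧ MemLp G 2 (volume.restrict Ω) ∧
    ∃ φ : ℕ → EuclideanSpace ℝ (Fin N) → ℝ, (∀ n, IsTestFunction ⊤ Ω (φ n)) ∧
      Tendsto (fun n => eLpNorm (fun x => φ n x - w x) 2 (volume.restrict Ω)) atTop (𝓝 0) ∧
      Tendsto (fun n => eLpNorm (fun x => gradient (φ n) x - G x) 2 (volume.restrict Ω))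
        atTop (𝓝 0)

/-- `w > 0` in `Ω`, in the sense that the essential infimum of `w` over every compact subset
of `Ω` is positive. -/
def LocallyEssPos {N : ℕ} (Ω : Set (EuclideanSpace ℝ (Fin N)))
    (w : EuclideanSpace ℝ (Fin N) → ℝ) : Prop :=
  ∀ K : Set (EuclideanSpace ℝ (Fin N)), IsCompact K → K ⊆ Ω →
    ∃ c : ℝ, 0 < c ∧ ∀ᵐ x ∂(volume.restrict K), c ≤ w x

/-- `w = 0` on `∂Ω`: `w` is nonnegative in `Ω` and `(w - ε)⁺ ∈ H¹₀(Ω)` for every `ε > 0`. -/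
def ZeroOnBoundary {N : ℕ} (Ω : Set (EuclideanSpace ℝ (Fin N)))
    (w : EuclideanSpace ℝ (Fin N) → ℝ) : Prop :=
  (∀ᵐ x ∂(volume.restrict Ω), 0 ≤ w x) ∧
  ∀ ε : ℝ, 0 < ε → MemH10 Ω (fun x => max (w x - ε) 0)

/-- `u ∈ H¹_loc(Ω)` is a weak solution of `-Δu = f / u^β`, `u > 0` in `Ω`, with `u = 0` on `∂Ω`.
The values of `u` and `f` outside `Ω` play no role. -/
def IsDirichletSolution {N : ℕ} (β : ℝ) (Ω : Set (EuclideanSpace ℝ (Fin N)))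
    (f u : EuclideanSpace ℝ (Fin N) → ℝ) : Prop :=
  (∃ G : EuclideanSpace ℝ (Fin N) → EuclideanSpace ℝ (Fin N), MemH1Loc Ω u G ∧
    ∀ φ : EuclideanSpace ℝ (Fin N) → ℝ, IsTestFunction 1 Ω φ →
      ∫ x in Ω, inner ℝ (G x) (gradient φ x) = ∫ x in Ω, f x / u x ^ β * φ x) ∧
  LocallyEssPos Ω u ∧ ZeroOnBoundary Ω u

/-- Reflection of `ℝᴺ` in the hyperplane `{x · ν = c}`, for a unit vector `ν`. -/
noncomputable def hyperplaneReflection {N : ℕ} (ν : EuclideanSpace ℝ (Fin N)) (c : ℝ)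
    (x : EuclideanSpace ℝ (Fin N)) : EuclideanSpace ℝ (Fin N) :=
  x - (2 * (inner ℝ x ν - c)) • ν

/-- The map `(x₁, x') ↦ (-x₁, x')`; the first coordinate has index `0`. -/
noncomputable def flipFirst {N : ℕ} [NeZero N] (x : EuclideanSpace ℝ (Fin N)) :
    EuclideanSpace ℝ (Fin N) :=
  WithLp.toLp 2 (fun i => if i = 0 then - x i else x i)

/-- The set `Ω` is symmetric under the involution `σ`. -/
def SetSymmetric {N : ℕ} (σ : EuclideanSpace ℝ (Fin N) → EuclideanSpace ℝ (Fin N))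
    (Ω : Set (EuclideanSpace ℝ (Fin N))) : Prop :=
  σ '' Ω = Ω

/-- The function `w` is symmetric (a.e.) in `Ω` under the involution `σ`. -/
def FunSymmetric {N : ℕ} (σ : EuclideanSpace ℝ (Fin N) → EuclideanSpace ℝ (Fin N))
    (Ω : Set (EuclideanSpace ℝ (Fin N))) (w : EuclideanSpace ℝ (Fin N) → ℝ) : Prop :=
  ∀ᵐ x ∂(volume.restrict Ω), w (σ x) = w x

/-- `w` coincides a.e. in `Ω` with a function of `|x|`. -/
def RadialOn {N : ℕ} (Ω : Set (EuclideanSpace ℝ (Fin N)))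
    (w : EuclideanSpace ℝ (Fin N) → ℝ) : Prop :=
  ∃ g : ℝ → ℝ, ∀ᵐ x ∂(volume.restrict Ω), w x = g ‖x‖

/-- `Ω` is an open ball or an open annulus centered at the origin. -/
def IsBallOrAnnulus {N : ℕ} (Ω : Set (EuclideanSpace ℝ (Fin N))) : Prop :=
  (∃ R : ℝ, 0 < R ∧ Ω = {x | ‖x‖ < R}) ∨
  (∃ r R : ℝ, 0 < r ∧ r < R ∧ Ω = {x | r < ‖x‖ ∧ ‖x‖ < R})

/-! Everything follows from comparison: two solutions satisfy `u ≤ v + ε` for every `ε > 0`.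
Formally one tests the difference of the equations with `W = (u - v - ε)⁺`. Where `W > 0` one has `v
< u`, hence `f / u ^ β ≤ f / v ^ β`, so the integral of `|∇(u - v)|²` over `{W > 0}` is at most zero
and `W` vanishes by Poincaré.

The difficulty is that `u` and `v` are only in `H¹_loc`, so `W` is not an admissible test function.
It is replaced by `min φₙ⁺ W`, where the test functions `φₙ` converge to `U = (u - ε)⁺` in `H¹` and
almost everywhere. These minima are compactly supported, and since `v > 0` gives `W < U` wherever `W
> 0`, they eventually equal `W` at almost every point. Passing to the limit requires `∇(u - v)` to
be square integrable on `{W > 0}`. For `∇u` this holds because `∇U` is `∇u` on `{u > ε}`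
(`gradient_posPart_sub_const`). For `∇v` it comes from testing the equation of `v`, as a
supersolution, with `(φₙ - v)⁺` (`IsWeakSolution.lintegral_gradient_le`,
`IsWeakSolution.memLp_indicator_gradient`). The argument is assembled in `IsWeakSolution.ae_le_add`.

Symmetry is a consequence of uniqueness: the equation and the boundary condition are invariant under
rigid motions, so `u ∘ σ` solves the same problem as `u`. For a ball or an annulus this applies to
every linear isometry. The exceptional null set depends on the isometry, so radiality is obtained
through averages over balls, which are invariant at every point
(`exists_radial_of_forall_isometry`). -/

open scoped ENNReal Convolution

/-! ### Convergence and Jensen's inequality in `L²`. -/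

section SquareIntegrable

variable {α F : Type*} [MeasurableSpace α] {μ : Measure α} [NormedAddCommGroup F]

lemma eLpNorm_two_sq (f : α → F) : eLpNorm f 2 μ ^ 2 = ∫⁻ x, ‖f x‖ₑ ^ 2 ∂μ := by
  have := eLpNorm_nnreal_pow_eq_lintegral (f := f) (μ := μ) (p := 2) (by norm_num)
  simpa using this

lemma tendsto_eLpNorm_two_iff {f : ℕ → α → F} :
    Tendsto (fun n => eLpNorm (f n) 2 μ) atTop (𝓝 0) ↔
      Tendsto (fun n => ∫⁻ x, ‖f n x‖ₑ ^ 2 ∂μ) atTop (𝓝 0) := by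
  simp_rw [← eLpNorm_two_sq]
  constructor
  · intro h
    have := (ENNReal.continuous_pow 2).continuousAt.tendsto.comp h
    rw [zero_pow two_ne_zero] at this
    exact this
  · intro h
    have := (ENNReal.continuous_rpow_const (y := 1/2)).continuousAt.tendsto.comp h
    simp only [Function.comp_def] at this
    rw [ENNReal.zero_rpow_of_pos (by norm_num)] at this
    refine this.congr fun n => ?_
    rw [← ENNReal.rpow_natCast, ← ENNReal.rpow_mul]
    norm_num

lemma tendsto_eLpNorm_two_of_dominated {f : ℕ → α → F} {g : α → F} {b : α → ℝ}
    (hf : ∀ n, AEStronglyMeasurable (f n) μ) (hg : AEStronglyMeasurable g μ) (hb : MemLp b 2 μ)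
    (hfb : ∀ n, ∀ᵐ x ∂μ, ‖f n x‖ ≤ b x)
    (hlim : ∀ᵐ x ∂μ, Tendsto (fun n => f n x) atTop (𝓝 (g x))) :
    Tendsto (fun n => eLpNorm (f n - g) 2 μ) atTop (𝓝 0) := by
  rw [tendsto_eLpNorm_two_iff]
  have hgb : ∀ᵐ x ∂μ, ‖g x‖ ≤ b x := by
    filter_upwards [hlim, ae_all_iff.2 hfb] with x h1 h2
    exact le_of_tendsto h1.norm (Eventually.of_forall h2)
  have key := tendsto_lintegral_of_dominated_convergence' (μ := μ)
    (F := fun n x => ‖(f n - g) x‖ₑ ^ 2) (f := fun _ => 0)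
    (fun x => ‖2 * b x‖ₑ ^ 2) (fun n => ((hf n).sub hg).enorm.pow_const 2) ?_ ?_ ?_
  · simpa using key
  · intro n
    filter_upwards [hfb n, hgb] with x h1 h2
    gcongr
    rw [enorm_le_iff_norm_le]
    have := norm_sub_le (f n x) (g x)
    have h3 := le_abs_self (2 * b x)
    simp only [Pi.sub_apply, Real.norm_eq_abs]
    linarith
  · have : MemLp (fun x => 2 * b x) 2 μ := hb.const_mul 2
    rw [← eLpNorm_two_sq]
    exact ENNReal.pow_ne_top this.2.ne
  · filter_upwards [hlim] with x h
    have : Tendsto (fun n => f n x - g x) atTop (𝓝 0) := by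
      simpa using h.sub_const (g x)
    have h2 : Tendsto (fun n => ‖f n x - g x‖ₑ ^ 2) atTop (𝓝 (‖(0 : F)‖ₑ ^ 2)) :=
      (ENNReal.continuous_pow 2).continuousAt.tendsto.comp
        ((continuous_enorm.tendsto (0 : F)).comp this)
    simpa using h2

lemma exists_seq_tendsto_ae_of_eLpNorm {f : ℕ → α → F} {g : α → F}
    (hf : ∀ n, AEStronglyMeasurable (f n) μ) (hg : AEStronglyMeasurable g μ)
    (h : Tendsto (fun n => eLpNorm (f n - g) 2 μ) atTop (𝓝 0)) :
    ∃ ns : ℕ → ℕ, StrictMono ns ∧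
      ∀ᵐ x ∂μ, Tendsto (fun i => f (ns i) x) atTop (𝓝 (g x)) :=
  (tendstoInMeasure_of_tendsto_eLpNorm (by norm_num) hf hg h).exists_seq_tendsto_ae

/-- With no increase of norm in the sequence, no mass can be lost in an almost everywhere limit. The
proof is Fatou applied to the nonnegative functions `2‖fₙ‖² + 2‖g‖² - ‖fₙ - g‖²`. It serves
mollification, where no pointwise dominating function is at hand. -/
lemma tendsto_eLpNorm_two_of_ae_of_le {f : ℕ → α → F} {g : α → F}
    (hf : ∀ n, AEStronglyMeasurable (f n) μ) (hg : MemLp g 2 μ)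
    (hle : ∀ n, eLpNorm (f n) 2 μ ≤ eLpNorm g 2 μ)
    (hlim : ∀ᵐ x ∂μ, Tendsto (fun n => f n x) atTop (𝓝 (g x))) :
    Tendsto (fun n => eLpNorm (f n - g) 2 μ) atTop (𝓝 0) := by
  rw [tendsto_eLpNorm_two_iff]
  set B : ℝ≥0∞ := ∫⁻ x, ‖g x‖ₑ ^ 2 ∂μ with hB
  have hBfin : B ≠ ∞ := by
    rw [hB, ← eLpNorm_two_sq]; exact ENNReal.pow_ne_top hg.2.ne
  set H : ℕ → α → ℝ≥0∞ := fun n x =>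
    2 * ‖f n x‖ₑ ^ 2 + 2 * ‖g x‖ₑ ^ 2 - ‖(f n - g) x‖ₑ ^ 2 with hH
  have hmD : ∀ n, AEMeasurable (fun x => ‖(f n - g) x‖ₑ ^ 2) μ :=
    fun n => ((hf n).sub hg.1).enorm.pow_const 2
  have hmH : ∀ n, AEMeasurable (H n) μ := fun n =>
    ((((hf n).enorm.pow_const 2).const_mul 2).add ((hg.1.enorm.pow_const 2).const_mul 2)).sub
      (hmD n)
  have hpar : ∀ n x, ‖(f n - g) x‖ₑ ^ 2 ≤ 2 * ‖f n x‖ₑ ^ 2 + 2 * ‖g x‖ₑ ^ 2 := by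
    intro n x
    rw [← ofReal_norm, ← ofReal_norm, ← ofReal_norm, ← ENNReal.ofReal_pow (norm_nonneg _),
      ← ENNReal.ofReal_pow (norm_nonneg _), ← ENNReal.ofReal_pow (norm_nonneg _)]
    rw [show (2 : ℝ≥0∞) = ENNReal.ofReal 2 by simp, ← ENNReal.ofReal_mul (by norm_num),
      ← ENNReal.ofReal_mul (by norm_num), ← ENNReal.ofReal_add (by positivity) (by positivity)]
    apply ENNReal.ofReal_le_ofReal
    have h1 := norm_sub_le (f n x) (g x)
    have h2 := norm_nonneg (f n x - g x)
    simp only [Pi.sub_apply]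
    nlinarith [sq_nonneg (‖f n x‖ - ‖g x‖), norm_nonneg (f n x), norm_nonneg (g x)]
  have hsum : ∀ n, ∫⁻ x, H n x ∂μ + ∫⁻ x, ‖(f n - g) x‖ₑ ^ 2 ∂μ ≤ 4 * B := by
    intro n
    rw [← lintegral_add_right' _ (hmD n)]
    have e : ∀ x, H n x + ‖(f n - g) x‖ₑ ^ 2 = 2 * ‖f n x‖ₑ ^ 2 + 2 * ‖g x‖ₑ ^ 2 :=
      fun x => tsub_add_cancel_of_le (hpar n x)
    simp_rw [e]
    rw [lintegral_add_right' _ ((hg.1.enorm.pow_const 2).const_mul 2),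
      lintegral_const_mul'' _ ((hf n).enorm.pow_const 2),
      lintegral_const_mul'' _ (hg.1.enorm.pow_const 2), ← hB, ← eLpNorm_two_sq]
    have : eLpNorm (f n) 2 μ ^ 2 ≤ B := by
      rw [hB, ← eLpNorm_two_sq]
      exact pow_le_pow_left' (hle n) 2
    calc _ ≤ 2 * B + 2 * B := by gcongr
      _ = 4 * B := by rw [← add_mul]; norm_num
  have hfatou : 4 * B ≤ liminf (fun n => ∫⁻ x, H n x ∂μ) atTop := by
    refine le_trans ?_ (lintegral_liminf_le' hmH)
    rw [hB, ← lintegral_const_mul'' _ (hg.1.enorm.pow_const 2)]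
    refine lintegral_mono_ae ?_
    filter_upwards [hlim] with x hx
    have h1 : Tendsto (fun n => ‖f n x‖ₑ ^ 2) atTop (𝓝 (‖g x‖ₑ ^ 2)) :=
      (ENNReal.continuous_pow 2).continuousAt.tendsto.comp
        ((continuous_enorm.tendsto (g x)).comp hx)
    have h2 : Tendsto (fun n => ‖(f n - g) x‖ₑ ^ 2) atTop (𝓝 0) := by
      have : Tendsto (fun n => f n x - g x) atTop (𝓝 0) := by simpa using hx.sub_const (g x)
      have h2 : Tendsto (fun n => ‖f n x - g x‖ₑ ^ 2) atTop (𝓝 (‖(0 : F)‖ₑ ^ 2)) :=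
        (ENNReal.continuous_pow 2).continuousAt.tendsto.comp
          ((continuous_enorm.tendsto (0 : F)).comp this)
      simpa using h2
    have h3 : Tendsto (fun n => H n x) atTop
        (𝓝 (2 * ‖g x‖ₑ ^ 2 + 2 * ‖g x‖ₑ ^ 2 - 0)) := by
      refine ENNReal.Tendsto.sub ?_ h2 (Or.inr (by simp))
      exact (ENNReal.Tendsto.const_mul h1 (Or.inr (by simp))).add tendsto_const_nhds
    rw [h3.liminf_eq, tsub_zero, ← add_mul]
    norm_num
  have hup : ∀ n, ∫⁻ x, ‖(f n - g) x‖ₑ ^ 2 ∂μ ≤ 4 * B - ∫⁻ x, H n x ∂μ := by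
    intro n
    refine ENNReal.le_sub_of_add_le_left ?_ (hsum n)
    exact ne_top_of_le_ne_top (ENNReal.mul_ne_top (by simp) hBfin) (le_self_add.trans (hsum n))
  -- Fatou bounds the integrals of `H n` below by `4 * B` in the limit and `hsum` bounds them above,
  -- so nothing is left for `‖fₙ - g‖²`.
  have hHlim : Tendsto (fun n => ∫⁻ x, H n x ∂μ) atTop (𝓝 (4 * B)) := by
    refine tendsto_of_le_liminf_of_limsup_le hfatou ?_
    refine limsup_le_of_le (by isBoundedDefault) (Eventually.of_forall fun n => ?_)
    exact le_self_add.trans (hsum n)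
  have h0 : Tendsto (fun n => 4 * B - ∫⁻ x, H n x ∂μ) atTop (𝓝 (4 * B - 4 * B)) :=
    ENNReal.Tendsto.sub tendsto_const_nhds hHlim (Or.inl (ENNReal.mul_ne_top (by simp) hBfin))
  rw [tsub_self] at h0
  exact tendsto_of_tendsto_of_tendsto_of_le_of_le tendsto_const_nhds h0 (fun _ => zero_le) hup

/-- Jensen for the square: with `ρ` as density one gets a probability measure, for which the `L¹`
norm is at most the `L²` norm. -/
lemma enorm_integral_sq_le {ρ : α → ℝ} {g : α → F} [NormedSpace ℝ F]
    (hρ : ∀ x, 0 ≤ ρ x) (hρm : Measurable ρ) (hρ1 : ∫⁻ x, ENNReal.ofReal (ρ x) ∂μ = 1)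
    (hg : AEStronglyMeasurable g μ) :
    ‖∫ x, ρ x • g x ∂μ‖ₑ ^ 2 ≤ ∫⁻ x, ENNReal.ofReal (ρ x) * ‖g x‖ₑ ^ 2 ∂μ := by
  set ν : Measure α := μ.withDensity fun x => ENNReal.ofReal (ρ x) with hν
  have hprob : IsProbabilityMeasure ν := ⟨by rw [hν, withDensity_apply _ .univ]; simpa using hρ1⟩
  have hgν : AEStronglyMeasurable g ν := hg.mono_ac (withDensity_absolutelyContinuous _ _)
  have h1 : ‖∫ x, ρ x • g x ∂μ‖ₑ ≤ eLpNorm g 1 ν := by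
    refine (enorm_integral_le_lintegral_enorm _).trans ?_
    rw [eLpNorm_one_eq_lintegral_enorm, hν,
      lintegral_withDensity_eq_lintegral_mul₀ hρm.ennreal_ofReal.aemeasurable hg.enorm]
    refine lintegral_mono fun x => ?_
    simp only [Pi.mul_apply, enorm_smul]
    rw [Real.enorm_eq_ofReal (hρ x)]
  calc ‖∫ x, ρ x • g x ∂μ‖ₑ ^ 2 ≤ eLpNorm g 2 ν ^ 2 := by
        gcongr
        exact h1.trans (eLpNorm_le_eLpNorm_of_exponent_le (by norm_num) hgν)
    _ = _ := by
        rw [eLpNorm_two_sq, hν, lintegral_withDensity_eq_lintegral_mul₀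
          hρm.ennreal_ofReal.aemeasurable (hg.enorm.pow_const 2)]
        rfl

end SquareIntegrable

/-! ### Mollification in `L²`. -/

section Mollification

variable {E F : Type*} [NormedAddCommGroup E] [InnerProductSpace ℝ E] [FiniteDimensional ℝ E]
  [MeasurableSpace E] [BorelSpace E] [NormedAddCommGroup F] [NormedSpace ℝ F]

/-- Jensen at each point, then Tonelli and translation invariance. -/
lemma eLpNorm_convolution_le (ρ : ContDiffBump (0 : E)) {g : E → F}
    (hg : AEStronglyMeasurable g volume) :
    eLpNorm (ρ.normed volume ⋆[ContinuousLinearMap.lsmul ℝ ℝ, volume] g) 2 volume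
      ≤ eLpNorm g 2 volume := by
  have hρ0 : ∀ x, 0 ≤ ρ.normed volume x := fun x => ρ.nonneg_normed x
  have hρc : Continuous (ρ.normed volume : E → ℝ) := ρ.continuous_normed
  have hρ1 : ∫⁻ x : E, ENNReal.ofReal (ρ.normed volume x) = 1 := by
    rw [← ofReal_integral_eq_lintegral_ofReal ρ.integrable_normed (Eventually.of_forall hρ0),
      ρ.integral_normed]
    simp
  have hsq : eLpNorm (ρ.normed volume ⋆[ContinuousLinearMap.lsmul ℝ ℝ, volume] g) 2 volume ^ 2
      ≤ eLpNorm g 2 volume ^ 2 := by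
    rw [eLpNorm_two_sq, eLpNorm_two_sq]
    have hq : AEMeasurable (fun x => ‖g x‖ₑ ^ 2) (volume : Measure E) := hg.enorm.pow_const 2
    calc ∫⁻ x, ‖(ρ.normed volume ⋆[ContinuousLinearMap.lsmul ℝ ℝ, volume] g) x‖ₑ ^ 2
        ≤ ∫⁻ x : E, ∫⁻ t : E, ENNReal.ofReal (ρ.normed volume t) * ‖g (x - t)‖ₑ ^ 2 := by
          refine lintegral_mono fun x => ?_
          have : AEStronglyMeasurable (fun t => g (x - t)) volume :=
            hg.comp_quasiMeasurePreserving
              (quasiMeasurePreserving_sub_left_of_right_invariant volume x)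
          exact enorm_integral_sq_le hρ0 hρc.measurable hρ1 this
      _ = ∫⁻ t : E, ∫⁻ x : E, ENNReal.ofReal (ρ.normed volume t) * ‖g (x - t)‖ₑ ^ 2 := by
          refine lintegral_lintegral_swap ?_
          change AEMeasurable (fun p : E × E => ENNReal.ofReal (ρ.normed volume p.2) *
            ‖g (p.1 - p.2)‖ₑ ^ 2) (volume.prod volume)
          have h1 : AEMeasurable (fun p : E × E => ENNReal.ofReal (ρ.normed volume p.2))
              (volume.prod volume) :=
            (hρc.measurable.ennreal_ofReal.comp measurable_snd).aemeasurable
          have h2 : AEMeasurable (fun p : E × E => ‖g (p.1 - p.2)‖ₑ ^ 2) (volume.prod volume) :=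
            hq.comp_quasiMeasurePreserving
              (quasiMeasurePreserving_sub_of_right_invariant volume volume)
          exact h1.mul h2
      _ = ∫⁻ t : E, ENNReal.ofReal (ρ.normed volume t) * ∫⁻ x : E, ‖g x‖ₑ ^ 2 := by
          refine lintegral_congr fun t => ?_
          rw [lintegral_const_mul' _ _ ENNReal.ofReal_ne_top,
            lintegral_sub_right_eq_self (fun x => ‖g x‖ₑ ^ 2) t]
      _ = ∫⁻ x : E, ‖g x‖ₑ ^ 2 := by
          rw [lintegral_mul_const _ hρc.measurable.ennreal_ofReal, hρ1, one_mul]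
  exact (ENNReal.pow_le_pow_left_iff (by norm_num)).1 hsq

lemma tendsto_eLpNorm_convolution_sub [CompleteSpace F] {ρ : ℕ → ContDiffBump (0 : E)} {C : ℝ}
    (hρ : Tendsto (fun i => (ρ i).rOut) atTop (𝓝 0))
    (hρ' : ∀ i, (ρ i).rOut ≤ C * (ρ i).rIn) {g : E → F} (hg : MemLp g 2 volume) :
    Tendsto (fun n => eLpNorm
      ((ρ n).normed volume ⋆[ContinuousLinearMap.lsmul ℝ ℝ, volume] g - g) 2 volume)
      atTop (𝓝 0) := by
  have hloc : LocallyIntegrable g volume := hg.locallyIntegrable (by norm_num)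
  refine tendsto_eLpNorm_two_of_ae_of_le (fun n => ?_) hg
    (fun n => eLpNorm_convolution_le (ρ n) hg.1)
    (ContDiffBump.ae_convolution_tendsto_right_of_locallyIntegrable hρ
      (Eventually.of_forall hρ') hloc)
  exact ((ρ n).hasCompactSupport_normed.continuous_convolution_left _
    (ρ n).continuous_normed hloc).aestronglyMeasurable

end Mollification

/-! ### Cauchy–Schwarz and limits of integrals of inner products. -/

section Holder

variable {α F : Type*} [MeasurableSpace α] {μ : Measure α} [NormedAddCommGroup F]
  [InnerProductSpace ℝ F]

lemma eLpNorm_inner_le {f g : α → F} (hf : AEStronglyMeasurable f μ)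
    (hg : AEStronglyMeasurable g μ) :
    eLpNorm (fun x => inner ℝ (f x) (g x)) 1 μ ≤ eLpNorm f 2 μ * eLpNorm g 2 μ := by
  refine eLpNorm_le_eLpNorm_mul_eLpNorm'_of_norm (p := 2) (q := 2) (r := 1) hf hg
    (fun a b => inner ℝ a b) 1 ?_ |>.trans ?_
  · filter_upwards with x
    simpa using norm_inner_le_norm (𝕜 := ℝ) (f x) (g x)
  · simp

lemma MemLp.integrable_inner_two {f g : α → F} (hf : MemLp f 2 μ) (hg : MemLp g 2 μ) :
    Integrable (fun x => inner ℝ (f x) (g x)) μ := by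
  rw [← memLp_one_iff_integrable]
  exact ⟨hf.1.inner hg.1, (eLpNorm_inner_le hf.1 hg.1).trans_lt (ENNReal.mul_lt_top hf.2 hg.2)⟩

lemma tendsto_integral_inner_left {f : ℕ → α → F} {f₀ g : α → F} (hf : ∀ n, MemLp (f n) 2 μ)
    (hf₀ : MemLp f₀ 2 μ) (hg : MemLp g 2 μ)
    (hlim : Tendsto (fun n => eLpNorm (f n - f₀) 2 μ) atTop (𝓝 0)) :
    Tendsto (fun n => ∫ x, inner ℝ (f n x) (g x) ∂μ) atTop
      (𝓝 (∫ x, inner ℝ (f₀ x) (g x) ∂μ)) := by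
  refine tendsto_integral_of_L1' _ (hf₀.1.inner hg.1)
    (Eventually.of_forall fun n => MemLp.integrable_inner_two (hf n) hg) ?_
  have h := ENNReal.Tendsto.mul_const hlim (b := eLpNorm g 2 μ) (Or.inr hg.2.ne)
  rw [zero_mul] at h
  refine tendsto_of_tendsto_of_tendsto_of_le_of_le tendsto_const_nhds h (fun _ => zero_le)
    fun n => ?_
  refine le_trans (le_of_eq ?_) (eLpNorm_inner_le ((hf n).sub hf₀).1 hg.1)
  congr 1
  ext x
  simp [inner_sub_left]

end Holder

lemma contDiff_comp_of_tsupport {E : Type*} [NormedAddCommGroup E] [NormedSpace ℝ E]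
    {φ : E → ℝ} {K : Set E}
    (h1 : ContDiff ℝ 1 φ) (h2 : tsupport φ ⊆ K) {F : ℝ → ℝ}
    (hF : ContDiff ℝ 1 F) (hF0 : F 0 = 0) :
    ContDiff ℝ 1 (fun x => F (φ x)) ∧ tsupport (fun x => F (φ x)) ⊆ K :=
  ⟨hF.comp h1, (closure_mono (Function.support_comp_subset hF0 φ)).trans h2⟩

/-! ### Calculus of the gradient of `C¹` functions. -/

section Gradient

variable {E : Type*} [NormedAddCommGroup E] [InnerProductSpace ℝ E] [CompleteSpace E]

lemma ContDiff.continuous_gradient {φ : E → ℝ} (h : ContDiff ℝ 1 φ) :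
    Continuous (gradient φ) :=
  (InnerProductSpace.toDual ℝ E).symm.continuous.comp (h.continuous_fderiv one_ne_zero)

lemma tsupport_gradient_subset (φ : E → ℝ) : tsupport (gradient φ) ⊆ tsupport φ := by
  refine (closure_mono fun x hx => ?_).trans (tsupport_fderiv_subset ℝ (f := φ))
  rw [Function.mem_support] at hx ⊢
  intro h
  exact hx (by simp [gradient, h])

lemma gradient_eq_zero_of_notMem_tsupport {φ : E → ℝ} {x : E} (hx : x ∉ tsupport φ) :
    gradient φ x = 0 :=
  image_eq_zero_of_notMem_tsupport fun h => hx (tsupport_gradient_subset φ h)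

lemma gradient_fun_sub {φ ψ : E → ℝ} {x : E} (hφ : DifferentiableAt ℝ φ x)
    (hψ : DifferentiableAt ℝ ψ x) :
    gradient (fun y => φ y - ψ y) x = gradient φ x - gradient ψ x := by
  simp only [gradient, ← map_sub]
  congr 1
  exact fderiv_sub hφ hψ

lemma gradient_fun_mul {φ ψ : E → ℝ} {x : E} (hφ : DifferentiableAt ℝ φ x)
    (hψ : DifferentiableAt ℝ ψ x) :
    gradient (fun y => φ y * ψ y) x = φ x • gradient ψ x + ψ x • gradient φ x := by
  simp only [gradient, ← map_smul, ← map_add]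
  congr 1
  exact fderiv_mul hφ hψ

lemma gradient_comp_real {φ : E → ℝ} {F : ℝ → ℝ} {x : E} (hφ : DifferentiableAt ℝ φ x)
    (hF : DifferentiableAt ℝ F (φ x)) :
    gradient (fun y => F (φ y)) x = deriv F (φ x) • gradient φ x := by
  simp only [gradient, ← map_smul]
  congr 1
  exact (hF.hasDerivAt.comp_hasFDerivAt x hφ.hasFDerivAt).fderiv

end Gradient

section Gradient

variable {E : Type*} [NormedAddCommGroup E] [InnerProductSpace ℝ E] [FiniteDimensional ℝ E]
  [MeasurableSpace E] [BorelSpace E]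

lemma memLp_of_tsupport_subset {K : Set E} (hK : IsCompact K) {φ : E → ℝ} (hφ : ContDiff ℝ 1 φ)
    (hs : tsupport φ ⊆ K) : MemLp φ 2 volume :=
  hφ.continuous.memLp_of_hasCompactSupport (hK.of_isClosed_subset (isClosed_tsupport _) hs)

lemma memLp_gradient_of_tsupport_subset {K : Set E} (hK : IsCompact K) {φ : E → ℝ}
    (hφ : ContDiff ℝ 1 φ) (hs : tsupport φ ⊆ K) : MemLp (gradient φ) 2 volume :=
  hφ.continuous_gradient.memLp_of_hasCompactSupport
    (hK.of_isClosed_subset (isClosed_tsupport _) ((tsupport_gradient_subset φ).trans hs))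

end Gradient

/-! ### Compactly supported `H¹` functions: chain rule, positive part, Poincaré inequality. -/

section H1Compact

variable {E : Type*} [NormedAddCommGroup E] [InnerProductSpace ℝ E] [FiniteDimensional ℝ E]
  [MeasurableSpace E] [BorelSpace E]

/-- `w` is an `H¹` function with gradient `G`, and is the `H¹`-limit of functions of class `C¹`
supported in `K`. -/
def H1Compact (K : Set E) (w : E → ℝ) (G : E → E) : Prop :=
  MemLp w 2 volume ∧ MemLp G 2 volume ∧ ∀ ε : ℝ≥0∞, 0 < ε → ∃ φ : E → ℝ,
    ContDiff ℝ 1 φ ∧ tsupport φ ⊆ K ∧ eLpNorm (φ - w) 2 volume ≤ ε ∧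
      eLpNorm (gradient φ - G) 2 volume ≤ ε

namespace H1Compact

variable {K K' : Set E} {w w' : E → ℝ} {G G' : E → E}

lemma mono (h : H1Compact K w G) (hK : K ⊆ K') : H1Compact K' w G :=
  ⟨h.1, h.2.1, fun ε hε => by
    obtain ⟨φ, h1, h2, h3⟩ := h.2.2 ε hε
    exact ⟨φ, h1, h2.trans hK, h3⟩⟩

lemma congr (h : H1Compact K w G) (hw : w =ᵐ[volume] w') (hG : G =ᵐ[volume] G') :
    H1Compact K w' G' := by
  refine ⟨h.1.ae_eq hw, h.2.1.ae_eq hG, fun ε hε => ?_⟩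
  obtain ⟨φ, h1, h2, h3, h4⟩ := h.2.2 ε hε
  refine ⟨φ, h1, h2, ?_, ?_⟩
  · rwa [← eLpNorm_congr_ae ((ae_eq_refl φ).sub hw)]
  · rwa [← eLpNorm_congr_ae ((ae_eq_refl (gradient φ)).sub hG)]

lemma of_contDiff (hK : IsCompact K) {φ : E → ℝ} (hφ : ContDiff ℝ 1 φ) (hs : tsupport φ ⊆ K) :
    H1Compact K φ (gradient φ) :=
  ⟨memLp_of_tsupport_subset hK hφ hs, memLp_gradient_of_tsupport_subset hK hφ hs,
    fun ε _ => ⟨φ, hφ, hs, by simp, by simp⟩⟩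

lemma sub (h : H1Compact K w G) (h' : H1Compact K w' G') :
    H1Compact K (w - w') (G - G') := by
  refine ⟨h.1.sub h'.1, h.2.1.sub h'.2.1, fun ε hε => ?_⟩
  obtain ⟨φ, h1, h2, h3, h4⟩ := h.2.2 (ε / 2) (ENNReal.half_pos hε.ne')
  obtain ⟨ψ, g1, g2, g3, g4⟩ := h'.2.2 (ε / 2) (ENNReal.half_pos hε.ne')
  have hgr : gradient (φ - ψ) = gradient φ - gradient ψ := by
    ext1 x
    exact gradient_fun_sub (h1.differentiable one_ne_zero x) (g1.differentiable one_ne_zero x)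
  refine ⟨φ - ψ, h1.sub g1, ?_, ?_, ?_⟩
  · refine (tsupport_sub φ ψ).trans (Set.union_subset h2 g2)
  · rw [show φ - ψ - (w - w') = (φ - w) - (ψ - w') by abel]
    refine (eLpNorm_sub_le (h1.continuous.aestronglyMeasurable.sub h.1.1)
      (g1.continuous.aestronglyMeasurable.sub h'.1.1) (by norm_num)).trans ?_
    exact (add_le_add h3 g3).trans_eq (ENNReal.add_halves ε)
  · rw [hgr, show gradient φ - gradient ψ - (G - G') = (gradient φ - G) - (gradient ψ - G') by abel]
    refine (eLpNorm_sub_le (h1.continuous_gradient.aestronglyMeasurable.sub h.2.1.1)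
      (g1.continuous_gradient.aestronglyMeasurable.sub h'.2.1.1) (by norm_num)).trans ?_
    exact (add_le_add h4 g4).trans_eq (ENNReal.add_halves ε)

lemma of_tendsto {wn : ℕ → E → ℝ} {Gn : ℕ → E → E} (h : ∀ n, H1Compact K (wn n) (Gn n))
    (hw : MemLp w 2 volume) (hG : MemLp G 2 volume)
    (hwn : Tendsto (fun n => eLpNorm (wn n - w) 2 volume) atTop (𝓝 0))
    (hGn : Tendsto (fun n => eLpNorm (Gn n - G) 2 volume) atTop (𝓝 0)) : H1Compact K w G := by
  refine ⟨hw, hG, fun ε hε => ?_⟩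
  have hε2 := ENNReal.half_pos hε.ne'
  obtain ⟨n, hn1, hn2⟩ := ((hwn.eventually_le_const hε2).and (hGn.eventually_le_const hε2)).exists
  obtain ⟨φ, h1, h2, h3, h4⟩ := (h n).2.2 (ε / 2) hε2
  refine ⟨φ, h1, h2, ?_, ?_⟩
  · rw [show φ - w = (φ - wn n) + (wn n - w) by abel]
    refine (eLpNorm_add_le (h1.continuous.aestronglyMeasurable.sub (h n).1.1)
      ((h n).1.1.sub hw.1) (by norm_num)).trans ?_
    exact (add_le_add h3 hn1).trans_eq (ENNReal.add_halves ε)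
  · rw [show gradient φ - G = (gradient φ - Gn n) + (Gn n - G) by abel]
    refine (eLpNorm_add_le (h1.continuous_gradient.aestronglyMeasurable.sub (h n).2.1.1)
      ((h n).2.1.1.sub hG.1) (by norm_num)).trans ?_
    exact (add_le_add h4 hn2).trans_eq (ENNReal.add_halves ε)

lemma exists_seq (h : H1Compact K w G) : ∃ φ : ℕ → E → ℝ,
    (∀ n, ContDiff ℝ 1 (φ n)) ∧ (∀ n, tsupport (φ n) ⊆ K) ∧
    Tendsto (fun n => eLpNorm (φ n - w) 2 volume) atTop (𝓝 0) ∧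
    Tendsto (fun n => eLpNorm (gradient (φ n) - G) 2 volume) atTop (𝓝 0) ∧
    ∀ᵐ x, Tendsto (fun n => φ n x) atTop (𝓝 (w x)) := by
  have hpos : ∀ n : ℕ, (0 : ℝ≥0∞) < ((n : ℝ≥0∞) + 1)⁻¹ := fun n => by
    rw [ENNReal.inv_pos]; finiteness
  have hz : Tendsto (fun n : ℕ => ((n : ℝ≥0∞) + 1)⁻¹) atTop (𝓝 0) := by
    have := (tendsto_add_atTop_iff_nat 1).2 ENNReal.tendsto_inv_nat_nhds_zero
    simpa using this
  choose φ h1 h2 h3 h4 using fun n : ℕ => h.2.2 _ (hpos n)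
  have t3 : Tendsto (fun n => eLpNorm (φ n - w) 2 volume) atTop (𝓝 0) :=
    tendsto_of_tendsto_of_tendsto_of_le_of_le tendsto_const_nhds hz (fun _ => zero_le) h3
  have t4 : Tendsto (fun n => eLpNorm (gradient (φ n) - G) 2 volume) atTop (𝓝 0) :=
    tendsto_of_tendsto_of_tendsto_of_le_of_le tendsto_const_nhds hz (fun _ => zero_le) h4
  obtain ⟨ns, hns, hae⟩ := exists_seq_tendsto_ae_of_eLpNorm
    (fun n => (h1 n).continuous.aestronglyMeasurable) h.1.1 t3
  exact ⟨fun n => φ (ns n), fun n => h1 _, fun n => h2 _, t3.comp hns.tendsto_atTop,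
    t4.comp hns.tendsto_atTop, hae⟩

/-- The chain rule by approximation. The gradient error splits as `F'(φₙ)(∇φₙ - G) + (F'(φₙ) -
F'(w))G`: the bound on `F'` controls the first term, and dominated convergence the second, which is
where convergence almost everywhere is needed. -/
lemma tendsto_comp (h : H1Compact K w G) {φ : ℕ → E → ℝ} (h1 : ∀ n, ContDiff ℝ 1 (φ n))
    (h3 : Tendsto (fun n => eLpNorm (φ n - w) 2 volume) atTop (𝓝 0))
    (h4 : Tendsto (fun n => eLpNorm (gradient (φ n) - G) 2 volume) atTop (𝓝 0))
    (h5 : ∀ᵐ x, Tendsto (fun n => φ n x) atTop (𝓝 (w x))) {F : ℝ → ℝ} (hF : ContDiff ℝ 1 F)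
    (hF0 : F 0 = 0) {C : ℝ} (hC : ∀ t, |deriv F t| ≤ C) :
    MemLp (fun x => F (w x)) 2 volume ∧ MemLp (fun x => deriv F (w x) • G x) 2 volume ∧
    Tendsto (fun n => eLpNorm ((fun x => F (φ n x)) - fun x => F (w x)) 2 volume) atTop (𝓝 0) ∧
    Tendsto (fun n => eLpNorm (gradient (fun x => F (φ n x)) - fun x => deriv F (w x) • G x) 2
      volume) atTop (𝓝 0) := by
  have hC0 : 0 ≤ C := (abs_nonneg _).trans (hC 0)
  have hdc : Continuous (deriv F) := hF.continuous_deriv le_rfl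
  have hLip : ∀ a b, |F a - F b| ≤ C * |a - b| := fun a b => by
    have := convex_univ.norm_image_sub_le_of_norm_deriv_le (f := F) (C := C) (x := b) (y := a)
      (fun x _ => hF.differentiable one_ne_zero x) (fun x _ => hC x) trivial trivial
    simpa using this
  have hwm : MemLp (fun x => F (w x)) 2 volume := by
    refine MemLp.of_le_mul (c := C) h.1 (hF.continuous.comp_aestronglyMeasurable h.1.1) ?_
    filter_upwards with x
    simpa [hF0] using hLip (w x) 0
  have hGm : MemLp (fun x => deriv F (w x) • G x) 2 volume := by
    refine MemLp.of_le_mul (c := C) h.2.1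
      ((hdc.comp_aestronglyMeasurable h.1.1).smul h.2.1.1) ?_
    filter_upwards with x
    rw [norm_smul]
    exact mul_le_mul_of_nonneg_right (hC _) (norm_nonneg _)
  have hgr : ∀ n, gradient (fun x => F (φ n x)) = fun x => deriv F (φ n x) • gradient (φ n) x :=
    fun n => funext fun x => gradient_comp_real ((h1 n).differentiable one_ne_zero x)
      (hF.differentiable one_ne_zero _)
  refine ⟨hwm, hGm, ?_, ?_⟩
  · have hz : Tendsto (fun n => ENNReal.ofReal C * eLpNorm (φ n - w) 2 volume) atTop (𝓝 0) := by
      simpa using ENNReal.Tendsto.const_mul (a := ENNReal.ofReal C) h3 (Or.inr (by simp))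
    refine tendsto_of_tendsto_of_tendsto_of_le_of_le tendsto_const_nhds hz (fun _ => zero_le)
      fun n => ?_
    refine eLpNorm_le_mul_eLpNorm_of_ae_le_mul ?_ 2
    filter_upwards with x
    exact hLip _ _
  · have a1 : Tendsto (fun n => ENNReal.ofReal C * eLpNorm (gradient (φ n) - G) 2 volume)
        atTop (𝓝 0) := by
      simpa using ENNReal.Tendsto.const_mul (a := ENNReal.ofReal C) h4 (Or.inr (by simp))
    have hm : ∀ n, AEStronglyMeasurable (fun x => deriv F (φ n x) • G x) volume := fun n =>
      (hdc.comp (h1 n).continuous).aestronglyMeasurable.smul h.2.1.1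
    have a2 : Tendsto (fun n => eLpNorm ((fun x => deriv F (φ n x) • G x) -
        fun x => deriv F (w x) • G x) 2 volume) atTop (𝓝 0) := by
      refine tendsto_eLpNorm_two_of_dominated hm hGm.1 (h.2.1.norm.const_mul C) (fun n => ?_) ?_
      · filter_upwards with x
        rw [norm_smul]
        exact mul_le_mul_of_nonneg_right (hC _) (norm_nonneg _)
      · filter_upwards [h5] with x hx
        exact ((hdc.tendsto _).comp hx).smul_const _
    have a3 := a1.add a2
    rw [add_zero] at a3
    refine tendsto_of_tendsto_of_tendsto_of_le_of_le tendsto_const_nhds a3 (fun _ => zero_le)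
      fun n => ?_
    rw [hgr n]
    have e : ((fun x => deriv F (φ n x) • gradient (φ n) x) - fun x => deriv F (w x) • G x)
        = (fun x => deriv F (φ n x) • (gradient (φ n) - G) x) +
          ((fun x => deriv F (φ n x) • G x) - fun x => deriv F (w x) • G x) := by
      ext1 x
      simp [smul_sub]
    rw [e]
    refine (eLpNorm_add_le ?_ ((hm n).sub hGm.1) (by norm_num)).trans (add_le_add_left ?_ _)
    · exact (hdc.comp (h1 n).continuous).aestronglyMeasurable.smul
        ((h1 n).continuous_gradient.aestronglyMeasurable.sub h.2.1.1)
    · refine eLpNorm_le_mul_eLpNorm_of_ae_le_mul ?_ 2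
      filter_upwards with x
      rw [norm_smul]
      exact mul_le_mul_of_nonneg_right (hC _) (norm_nonneg _)

lemma comp (hK : IsCompact K) (h : H1Compact K w G) {F : ℝ → ℝ} (hF : ContDiff ℝ 1 F)
    (hF0 : F 0 = 0) {C : ℝ} (hC : ∀ t, |deriv F t| ≤ C) :
    H1Compact K (fun x => F (w x)) (fun x => deriv F (w x) • G x) := by
  obtain ⟨φ, h1, h2, h3, h4, h5⟩ := h.exists_seq
  obtain ⟨m1, m2, t1, t2⟩ := h.tendsto_comp h1 h3 h4 h5 hF hF0 hC
  refine of_tendsto (fun n => ?_) m1 m2 t1 t2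
  obtain ⟨c1, c2⟩ := contDiff_comp_of_tsupport (h1 n) (h2 n) hF hF0
  exact of_contDiff hK c1 c2

end H1Compact

/-- A smooth approximation from below of the positive part. -/
noncomputable def smoothPos (t : ℝ) : ℝ := t * Real.smoothTransition t

lemma contDiff_smoothPos : ContDiff ℝ 1 smoothPos :=
  contDiff_id.mul Real.smoothTransition.contDiff

lemma smoothPos_of_nonpos {t : ℝ} (h : t ≤ 0) : smoothPos t = 0 := by
  simp [smoothPos, Real.smoothTransition.zero_of_nonpos h]

lemma smoothPos_of_one_le {t : ℝ} (h : 1 ≤ t) : smoothPos t = t := by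
  simp [smoothPos, Real.smoothTransition.one_of_one_le h]

/-- The value at `0` itself follows by continuity of the derivative. Including it makes the gradient
of the positive part live on the strict set `{0 < w}`. -/
lemma deriv_smoothPos_of_nonpos {t : ℝ} (h : t ≤ 0) : deriv smoothPos t = 0 := by
  have hc : Continuous (deriv smoothPos) := contDiff_smoothPos.continuous_deriv le_rfl
  have hlt : ∀ s < 0, deriv smoothPos s = 0 := fun s hs => by
    have : smoothPos =ᶠ[𝓝 s] fun _ => 0 := by
      filter_upwards [Iio_mem_nhds hs] with r hr
      exact smoothPos_of_nonpos (le_of_lt hr)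
    simp [this.deriv_eq]
  have hcl : IsClosed {s | deriv smoothPos s = 0} := isClosed_eq hc continuous_const
  have : Set.Iic (0 : ℝ) ⊆ {s | deriv smoothPos s = 0} := by
    rw [← closure_Iio]
    exact hcl.closure_subset_iff.2 hlt
  exact this h

lemma deriv_smoothPos_of_one_lt {t : ℝ} (h : 1 < t) : deriv smoothPos t = 1 := by
  have : smoothPos =ᶠ[𝓝 t] fun s => s := by
    filter_upwards [Ioi_mem_nhds h] with r hr
    exact smoothPos_of_one_le (le_of_lt hr)
  simp [this.deriv_eq]

lemma exists_bound_deriv_smoothPos : ∃ C, ∀ t, |deriv smoothPos t| ≤ C := by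
  have hc : Continuous (deriv smoothPos) := contDiff_smoothPos.continuous_deriv le_rfl
  obtain ⟨C, hC⟩ := (isCompact_Icc (a := (0 : ℝ)) (b := 1)).exists_bound_of_continuousOn
    hc.continuousOn
  refine ⟨max C 1, fun t => ?_⟩
  rcases le_or_gt t 0 with h | h
  · simp [deriv_smoothPos_of_nonpos h]
  rcases le_or_gt t 1 with h' | h'
  · exact (hC t ⟨h.le, h'⟩).trans (le_max_left _ _)
  · simp [deriv_smoothPos_of_one_lt h']

namespace H1Compact

variable {K : Set E} {w : E → ℝ} {G : E → E}

lemma posPart (hK : IsCompact K) (h : H1Compact K w G) :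
    H1Compact K (fun x => max (w x) 0) ({x | 0 < w x}.indicator G) := by
  obtain ⟨C, hC⟩ := exists_bound_deriv_smoothPos
  have hC0 : 0 ≤ C := (abs_nonneg _).trans (hC 0)
  -- The rescaling confines the transition to `0 < t < 1 / (n + 1)` and leaves the bound `C` on the
  -- derivative unchanged, so dominated convergence applies to both values and gradients.
  set F : ℕ → ℝ → ℝ := fun n t => ((n : ℝ) + 1)⁻¹ * smoothPos (((n : ℝ) + 1) * t) with hFdef
  have hn : ∀ n : ℕ, (0 : ℝ) < (n : ℝ) + 1 := fun n => by positivity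
  have hFc : ∀ n, ContDiff ℝ 1 (F n) := fun n =>
    contDiff_const.mul (contDiff_smoothPos.comp (contDiff_const.mul contDiff_id))
  have hFd : ∀ n t, deriv (F n) t = deriv smoothPos (((n : ℝ) + 1) * t) := fun n t => by
    have h1 : HasDerivAt smoothPos (deriv smoothPos (((n : ℝ) + 1) * t)) (((n : ℝ) + 1) * t) :=
      (contDiff_smoothPos.differentiable one_ne_zero _).hasDerivAt
    have h2 : HasDerivAt (fun s : ℝ => ((n : ℝ) + 1) * s) ((n : ℝ) + 1) t := by
      simpa using (hasDerivAt_id t).const_mul ((n : ℝ) + 1)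
    have h3 := (h1.comp t h2).const_mul (((n : ℝ) + 1)⁻¹)
    rw [show deriv (F n) t = _ from HasDerivAt.deriv h3]
    field_simp [(hn n).ne']
  have hF0 : ∀ n, F n 0 = 0 := fun n => by simp [hFdef, smoothPos]
  have hFC : ∀ n t, |deriv (F n) t| ≤ C := fun n t => by rw [hFd]; exact hC _
  have hcomp := fun n => h.comp hK (hFc n) (hF0 n) (hFC n)
  have hLip : ∀ n t, |F n t| ≤ C * |t| := fun n t => by
    have := convex_univ.norm_image_sub_le_of_norm_deriv_le (f := F n) (C := C) (x := 0) (y := t)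
      (fun x _ => (hFc n).differentiable one_ne_zero x) (fun x _ => hFC n x) trivial trivial
    simpa [hF0] using this
  have hlarge : ∀ t : ℝ, 0 < t → ∀ᶠ n : ℕ in atTop, 1 < ((n : ℝ) + 1) * t := fun t ht => by
    have : Tendsto (fun n : ℕ => ((n : ℝ) + 1) * t) atTop atTop :=
      (tendsto_atTop_add_const_right _ _ tendsto_natCast_atTop_atTop).atTop_mul_const ht
    exact this.eventually_gt_atTop 1
  have hmeas : NullMeasurableSet {x | 0 < w x} volume :=
    nullMeasurableSet_lt aemeasurable_const h.1.1.aemeasurable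
  have hm1 : MemLp (fun x => max (w x) 0) 2 volume := h.1.pos_part
  have hm2 : MemLp ({x | 0 < w x}.indicator G) 2 volume := by
    refine h.2.1.mono (h.2.1.1.indicator₀ hmeas) (Eventually.of_forall fun x => ?_)
    exact norm_indicator_le_norm_self _ _
  refine of_tendsto hcomp hm1 hm2 ?_ ?_
  · refine tendsto_eLpNorm_two_of_dominated (fun n => (hcomp n).1.1) hm1.1 (h.1.norm.const_mul C)
      (fun n => Eventually.of_forall fun x => hLip n _) (Eventually.of_forall fun x => ?_)
    rcases le_or_gt (w x) 0 with hx | hx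
    · refine tendsto_const_nhds.congr fun n => ?_
      rw [max_eq_right hx, hFdef]
      simp [smoothPos_of_nonpos (mul_nonpos_of_nonneg_of_nonpos (hn n).le hx)]
    · rw [max_eq_left hx.le]
      refine tendsto_const_nhds.congr' ?_
      filter_upwards [hlarge _ hx] with n h1
      simp only [hFdef]
      rw [smoothPos_of_one_le h1.le]
      field_simp [(hn n).ne']
  · refine tendsto_eLpNorm_two_of_dominated (fun n => (hcomp n).2.1.1) hm2.1
      (h.2.1.norm.const_mul C) (fun n => Eventually.of_forall fun x => ?_)
      (Eventually.of_forall fun x => ?_)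
    · rw [norm_smul]
      exact mul_le_mul_of_nonneg_right (hFC n _) (norm_nonneg _)
    · rcases le_or_gt (w x) 0 with hx | hx
      · refine tendsto_const_nhds.congr fun n => ?_
        rw [hFd, deriv_smoothPos_of_nonpos (mul_nonpos_of_nonneg_of_nonpos (hn n).le hx)]
        simp [hx.not_gt]
      · refine tendsto_const_nhds.congr' ?_
        filter_upwards [hlarge _ hx] with n h1
        rw [hFd, deriv_smoothPos_of_one_lt h1]
        simp [hx]

/-- Integration by parts survives `L²` limits; thus the approximate gradient `G` is also the weak
gradient. -/
lemma integral_mul_gradient (hK : IsCompact K) (h : H1Compact K w G) {ζ : E → ℝ}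
    (hζ : ContDiff ℝ 1 ζ) (hζc : HasCompactSupport ζ) (v : E) :
    ∫ x, w x * inner ℝ (gradient ζ x) v = - ∫ x, inner ℝ (G x) v * ζ x := by
  obtain ⟨φ, h1, h2, h3, h4, -⟩ := h.exists_seq
  have hζg : MemLp (fun x => inner ℝ (gradient ζ x) v) 2 volume :=
    (memLp_gradient_of_tsupport_subset hζc.isCompact hζ subset_rfl).inner_const v
  have hζv : MemLp (fun x => ζ x • v) 2 volume :=
    (hζ.continuous.smul continuous_const).memLp_of_hasCompactSupport hζc.smul_right
  have l1 := tendsto_integral_inner_left (fun n => memLp_of_tsupport_subset hK (h1 n) (h2 n))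
    h.1 hζg h3
  have l2 := tendsto_integral_inner_left
    (fun n => memLp_gradient_of_tsupport_subset hK (h1 n) (h2 n)) h.2.1 hζv h4
  have e : ∀ n, ∫ x, inner ℝ (φ n x) (inner ℝ (gradient ζ x) v) =
      - ∫ x, inner ℝ (gradient (φ n) x) (ζ x • v) := fun n => by
    have hfc : HasCompactSupport (φ n) := hK.of_isClosed_subset (isClosed_tsupport _) (h2 n)
    have i1 : Continuous fun x => fderiv ℝ (φ n) x v :=
      ((h1 n).continuous_fderiv one_ne_zero).clm_apply continuous_const
    have i2 : Continuous fun x => fderiv ℝ ζ x v :=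
      (hζ.continuous_fderiv one_ne_zero).clm_apply continuous_const
    have := integral_mul_fderiv_eq_neg_fderiv_mul_of_integrable (μ := (volume : Measure E))
      (f := φ n) (g := ζ) (v := v)
      ((i1.mul hζ.continuous).integrable_of_hasCompactSupport hζc.mul_left)
      (((h1 n).continuous.mul i2).integrable_of_hasCompactSupport hfc.mul_right)
      (((h1 n).continuous.mul hζ.continuous).integrable_of_hasCompactSupport hfc.mul_right)
      (fun x _ => (h1 n).differentiable one_ne_zero x)
      (fun x _ => hζ.differentiable one_ne_zero x)
    simp only [inner_smul_right, inner_gradient_left, RCLike.inner_apply]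
    simpa [mul_comm] using this
  simp_rw [e] at l1
  have := tendsto_nhds_unique l1 l2.neg
  simpa [inner_smul_right, mul_comm] using this

/-- The function `⟪v, x⟫` has derivative `1` along `v`, so integrating `φ²` against it by parts
gives `∫ φ² = -∫ 2 φ (∂ᵥφ) ⟪v, x⟫`. On the support `|⟪v, x⟫| ≤ R`, and Young's inequality absorbs
half of `∫ φ²`. -/
lemma eLpNorm_le_of_contDiff {R : ℝ} (hR : 0 ≤ R) {v : E} (hv : ‖v‖ = 1) {φ : E → ℝ}
    (hφ : ContDiff ℝ 1 φ) (hs : tsupport φ ⊆ Metric.closedBall 0 R) :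
    eLpNorm φ 2 volume ≤ ENNReal.ofReal (2 * R) * eLpNorm (gradient φ) 2 volume := by
  have hK := isCompact_closedBall (0 : E) R
  have hfc : HasCompactSupport φ := hK.of_isClosed_subset (isClosed_tsupport _) hs
  have m1 := memLp_of_tsupport_subset hK hφ hs
  have m2 := memLp_gradient_of_tsupport_subset hK hφ hs
  have I1 : Integrable (fun x => φ x ^ 2) volume := m1.integrable_sq
  have I2 : Integrable (fun x => ‖gradient φ x‖ ^ 2) volume := m2.norm.integrable_sq
  have hd : ∀ x, HasFDerivAt (fun x => φ x ^ 2) ((2 * φ x) • fderiv ℝ φ x) x := fun x => by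
    simpa [two_mul] using (hφ.differentiable one_ne_zero x).hasFDerivAt.pow 2
  have hl : ∀ x, HasFDerivAt (fun x : E => inner ℝ v x) (innerSL ℝ v) x := fun x =>
    (innerSL ℝ v).hasFDerivAt
  have i1 : Continuous fun x => fderiv ℝ φ x v :=
    (hφ.continuous_fderiv one_ne_zero).clm_apply continuous_const
  have hsq : HasCompactSupport fun x => φ x ^ 2 := hfc.comp_left (g := fun t : ℝ => t ^ 2) (by simp)
  have hcl : Continuous fun x : E => inner ℝ v x := by fun_prop
  have hint : Integrable (fun x => (2 * φ x) * fderiv ℝ φ x v * inner ℝ v x) volume := by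
    refine (((continuous_const.mul hφ.continuous).mul i1).mul hcl).integrable_of_hasCompactSupport
      ?_
    exact ((hfc.mul_left (f := fun _ => 2)).mul_right).mul_right
  have ibp := integral_mul_fderiv_eq_neg_fderiv_mul_of_integrable (μ := (volume : Measure E))
    (f := fun x => φ x ^ 2) (g := fun x => inner ℝ v x) (v := v)
    (by simpa [(hd _).fderiv] using hint)
    (by simpa [(hl _).fderiv, hv] using I1)
    (((hφ.continuous.pow 2).mul hcl).integrable_of_hasCompactSupport hsq.mul_right)
    (fun x _ => (hd x).differentiableAt) (fun x _ => (hl x).differentiableAt)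
  simp only [(hd _).fderiv, (hl _).fderiv, innerSL_apply_apply, real_inner_self_eq_norm_sq, hv,
    one_pow, mul_one, smul_apply, smul_eq_mul] at ibp
  have hle : ∫ x, φ x ^ 2 ≤ ∫ x, (1 / 2 * φ x ^ 2 + 2 * R ^ 2 * ‖gradient φ x‖ ^ 2) := by
    rw [ibp, ← integral_neg]
    refine integral_mono hint.neg ((I1.const_mul _).add (I2.const_mul _)) fun x => ?_
    by_cases hx : x ∈ tsupport φ
    · have hxR : ‖x‖ ≤ R := by simpa using hs hx
      have b1 : |inner ℝ v x| ≤ R := by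
        simpa [hv] using (abs_real_inner_le_norm v x).trans (by rw [hv, one_mul]; exact hxR)
      have b2 : |fderiv ℝ φ x v| ≤ ‖gradient φ x‖ := by
        rw [← inner_gradient_left]
        simpa [hv] using abs_real_inner_le_norm (gradient φ x) v
      have b3 : -(2 * φ x * fderiv ℝ φ x v * inner ℝ v x) ≤ 2 * |φ x| * ‖gradient φ x‖ * R := by
        refine (neg_le_abs _).trans ?_
        rw [abs_mul, abs_mul, abs_mul, abs_two]
        gcongr
      have b4 := sq_nonneg (|φ x| - 2 * R * ‖gradient φ x‖)
      have b5 := sq_abs (φ x)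
      simp only
      nlinarith
    · simp [image_eq_zero_of_notMem_tsupport hx, gradient_eq_zero_of_notMem_tsupport hx]
  rw [integral_add (I1.const_mul _) (I2.const_mul _), integral_const_mul, integral_const_mul] at hle
  have hle2 : ∫ x, φ x ^ 2 ≤ (2 * R) ^ 2 * ∫ x, ‖gradient φ x‖ ^ 2 := by nlinarith
  refine (ENNReal.pow_le_pow_left_iff (n := 2) (by norm_num)).1 ?_
  rw [mul_pow, eLpNorm_two_sq, eLpNorm_two_sq, ← ENNReal.ofReal_pow (by positivity)]
  have c1 : ∫⁻ x, ‖φ x‖ₑ ^ 2 = ENNReal.ofReal (∫ x, φ x ^ 2) := by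
    rw [ofReal_integral_eq_lintegral_ofReal I1 (Eventually.of_forall fun x => sq_nonneg _)]
    refine lintegral_congr fun x => ?_
    rw [← ofReal_norm, ← ENNReal.ofReal_pow (norm_nonneg _), Real.norm_eq_abs, sq_abs]
  have c2 : ∫⁻ x, ‖gradient φ x‖ₑ ^ 2 = ENNReal.ofReal (∫ x, ‖gradient φ x‖ ^ 2) := by
    rw [ofReal_integral_eq_lintegral_ofReal I2 (Eventually.of_forall fun x => sq_nonneg _)]
    refine lintegral_congr fun x => ?_
    rw [← ofReal_norm, ← ENNReal.ofReal_pow (norm_nonneg _)]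
  rw [c1, c2, ← ENNReal.ofReal_mul (by positivity)]
  exact ENNReal.ofReal_le_ofReal hle2

/-- The **Poincaré inequality**. -/
lemma poincare [Nontrivial E] {R : ℝ} (hR : 0 ≤ R) (h : H1Compact K w G)
    (hKR : K ⊆ Metric.closedBall 0 R) :
    eLpNorm w 2 volume ≤ ENNReal.ofReal (2 * R) * eLpNorm G 2 volume := by
  obtain ⟨v, hv⟩ := exists_norm_eq E (c := 1) zero_le_one
  obtain ⟨φ, h1, h2, h3, h4, -⟩ := h.exists_seq
  have key : ∀ n, eLpNorm w 2 volume ≤ eLpNorm (φ n - w) 2 volume +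
      ENNReal.ofReal (2 * R) * (eLpNorm (gradient (φ n) - G) 2 volume + eLpNorm G 2 volume) := by
    intro n
    have m := (h1 n).continuous.aestronglyMeasurable (μ := (volume : Measure E))
    have mg := (h1 n).continuous_gradient.aestronglyMeasurable (μ := (volume : Measure E))
    calc eLpNorm w 2 volume = eLpNorm (φ n - (φ n - w)) 2 volume := by congr 1; abel
      _ ≤ eLpNorm (φ n) 2 volume + eLpNorm (φ n - w) 2 volume :=
          eLpNorm_sub_le m (m.sub h.1.1) (by norm_num)
      _ ≤ ENNReal.ofReal (2 * R) * eLpNorm (gradient (φ n) - G + G) 2 volume +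
          eLpNorm (φ n - w) 2 volume := by
          rw [sub_add_cancel]
          gcongr
          exact eLpNorm_le_of_contDiff hR hv (h1 n) ((h2 n).trans hKR)
      _ ≤ ENNReal.ofReal (2 * R) * (eLpNorm (gradient (φ n) - G) 2 volume + eLpNorm G 2 volume) +
          eLpNorm (φ n - w) 2 volume := by
          gcongr
          exact eLpNorm_add_le (mg.sub h.2.1.1) h.2.1.1 (by norm_num)
      _ = _ := add_comm _ _
  have hlim := h3.add (ENNReal.Tendsto.const_mul (a := ENNReal.ofReal (2 * R))
    (h4.add_const (eLpNorm G 2 volume)) (Or.inr ENNReal.ofReal_ne_top))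
  simp only [zero_add] at hlim
  exact ge_of_tendsto' hlim key

end H1Compact

end H1Compact

/-! ### Weak gradients with compact support are strong `L²` limits. -/

section Mollification

variable {E : Type*} [NormedAddCommGroup E] [InnerProductSpace ℝ E] [FiniteDimensional ℝ E]
  [MeasurableSpace E] [BorelSpace E]

/-- The derivative falls on `ρ`, and `t ↦ ρ (x - t)` is itself a test function; the sign from this
reflection cancels the sign in the definition of the weak gradient. -/
lemma gradient_convolution_eq {ρ : E → ℝ} (hρ : ContDiff ℝ (⊤ : ℕ∞) ρ) (hρc : HasCompactSupport ρ)
    {w : E → ℝ} {G : E → E} (hw : LocallyIntegrable w volume) (hG : LocallyIntegrable G volume)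
    (hwG : ∀ φ : E → ℝ, ContDiff ℝ (⊤ : ℕ∞) φ → HasCompactSupport φ → ∀ v : E,
      ∫ x, w x * inner ℝ (gradient φ x) v = - ∫ x, inner ℝ (G x) v * φ x) :
    gradient (ρ ⋆[ContinuousLinearMap.lsmul ℝ ℝ, volume] w) =
      ρ ⋆[ContinuousLinearMap.lsmul ℝ ℝ, volume] G := by
  have hρ1 : ContDiff ℝ 1 ρ := hρ.of_le (by exact_mod_cast le_top)
  ext1 x
  refine ext_inner_right ℝ fun v => ?_
  set ζ : E → ℝ := fun t => ρ (x - t) with hζ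
  have hζs : ContDiff ℝ (⊤ : ℕ∞) ζ := hρ.comp (contDiff_const.sub contDiff_id)
  have hζc : HasCompactSupport ζ := hρc.comp_homeomorph (Homeomorph.subLeft x)
  have hζd : ∀ t, inner ℝ (gradient ζ t) v = - fderiv ℝ ρ (x - t) v := fun t => by
    rw [inner_gradient_left]
    have h1 : HasFDerivAt (fun t => x - t) (-ContinuousLinearMap.id ℝ E) t := by
      simpa using (hasFDerivAt_id t).const_sub x
    have h2 := ((hρ1.differentiable one_ne_zero (x - t)).hasFDerivAt.comp t h1)
    rw [show fderiv ℝ ζ t = _ from h2.fderiv]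
    simp
  have h1 := hwG ζ hζs hζc v
  have hGint : Integrable (fun t => ζ t • G t) volume :=
    hG.integrable_smul_left_of_hasCompactSupport hζs.continuous hζc
  rw [inner_gradient_left, (hρc.hasFDerivAt_convolution_left _ hρ1 hw x).fderiv,
    convolution_eq_swap, convolution_eq_swap]
  have hex := (hρc.fderiv ℝ).convolutionExists_left
    (ContinuousLinearMap.precompL E (ContinuousLinearMap.lsmul ℝ ℝ))
    (hρ1.continuous_fderiv one_ne_zero) hw x
  rw [ContinuousLinearMap.integral_apply hex.integrable_swap]
  simp only [ContinuousLinearMap.precompL_apply, ContinuousLinearMap.lsmul_apply, smul_eq_mul]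
  simp only [hζd] at h1
  have h2 : ∫ t, fderiv ℝ ρ (x - t) v * w t = ∫ t, inner ℝ (G t) v * ζ t := by
    rw [← neg_inj, ← h1, ← integral_neg]
    exact integral_congr_ae (Eventually.of_forall fun t => by simp [mul_comm])
  rw [h2, real_inner_comm]
  have h3 := integral_inner (𝕜 := ℝ) hGint v
  rw [← h3]
  exact integral_congr_ae (Eventually.of_forall fun t => by
    simp [inner_smul_right, real_inner_comm, mul_comm])

lemma H1Compact.of_hasWeakGradient {K : Set E} (hK : IsCompact K) {w : E → ℝ} {G : E → E}
    (hw : MemLp w 2 volume) (hG : MemLp G 2 volume) (hwK : ∀ x ∉ K, w x = 0)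
    (hwG : ∀ φ : E → ℝ, ContDiff ℝ (⊤ : ℕ∞) φ → HasCompactSupport φ → ∀ v : E,
      ∫ x, w x * inner ℝ (gradient φ x) v = - ∫ x, inner ℝ (G x) v * φ x)
    {δ : ℝ} (hδ : 0 < δ) : H1Compact (Metric.cthickening δ K) w G := by
  have hpos : ∀ n : ℕ, 0 < δ / ((n : ℝ) + 1) := fun n => by positivity
  -- Outer radii at most `δ` keep the mollified functions inside the thickening. The fixed ratio `2`
  -- of the radii is what almost everywhere convergence requires.
  let ρ : ℕ → ContDiffBump (0 : E) := fun n =>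
    ⟨δ / ((n : ℝ) + 1) / 2, δ / ((n : ℝ) + 1), half_pos (hpos n), half_lt_self (hpos n)⟩
  have hρ0 : Tendsto (fun n => (ρ n).rOut) atTop (𝓝 0) := by
    have := tendsto_one_div_add_atTop_nhds_zero_nat (𝕜 := ℝ) |>.const_mul δ
    simpa [ρ, div_eq_mul_inv] using this
  have hρC : ∀ n, (ρ n).rOut ≤ 2 * (ρ n).rIn := fun n => by simp only [ρ]; linarith
  have hwl : LocallyIntegrable w volume := hw.locallyIntegrable (by norm_num)
  have hGl : LocallyIntegrable G volume := hG.locallyIntegrable (by norm_num)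
  have hgr : ∀ n, gradient ((ρ n).normed volume ⋆[ContinuousLinearMap.lsmul ℝ ℝ, volume] w) =
      (ρ n).normed volume ⋆[ContinuousLinearMap.lsmul ℝ ℝ, volume] G := fun n =>
    gradient_convolution_eq (ρ n).contDiff_normed (ρ n).hasCompactSupport_normed hwl hGl hwG
  refine H1Compact.of_tendsto
    (wn := fun n => (ρ n).normed volume ⋆[ContinuousLinearMap.lsmul ℝ ℝ, volume] w)
    (Gn := fun n => gradient
      ((ρ n).normed volume ⋆[ContinuousLinearMap.lsmul ℝ ℝ, volume] w))
    (fun n => H1Compact.of_contDiff hK.cthickening ?_ ?_) hw hG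
    (tendsto_eLpNorm_convolution_sub hρ0 hρC hw) ?_
  · exact (ρ n).hasCompactSupport_normed.contDiff_convolution_left _ (ρ n).contDiff_normed hwl
  · refine closure_minimal ?_ Metric.isClosed_cthickening
    refine (support_convolution_subset _).trans ?_
    rintro _ ⟨a, ha, b, hb, rfl⟩
    have hbK : b ∈ K := by
      by_contra hc
      exact hb (hwK b hc)
    rw [(ρ n).support_normed_eq] at ha
    refine Metric.mem_cthickening_of_dist_le _ b δ K hbK ?_
    have : ‖a‖ < δ / ((n : ℝ) + 1) := by simpa [ρ] using ha
    have h2 : δ / ((n : ℝ) + 1) ≤ δ := div_le_self hδ.le (by simp)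
    simpa [dist_eq_norm] using (this.trans_le h2).le
  · simp_rw [hgr]
    exact tendsto_eLpNorm_convolution_sub hρ0 hρC hG

end Mollification

/-! ### Localization by cutoff functions. -/

section Cutoff

variable {N : ℕ} {Ω : Set (EuclideanSpace ℝ (Fin N))}

lemma IsTestFunction.contDiff_one {φ : EuclideanSpace ℝ (Fin N) → ℝ}
    (h : IsTestFunction ⊤ Ω φ) : ContDiff ℝ 1 φ :=
  h.1.of_le (by exact_mod_cast le_top)

lemma integrable_smul_of_locallyIntegrableOn {F : Type*} [NormedAddCommGroup F] [NormedSpace ℝ F]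
    {g : EuclideanSpace ℝ (Fin N) → ℝ} {w : EuclideanSpace ℝ (Fin N) → F}
    (hw : LocallyIntegrableOn w Ω volume) (hg : Continuous g) (hgc : HasCompactSupport g)
    (hgs : tsupport g ⊆ Ω) : Integrable (fun x => g x • w x) volume := by
  have h1 : IntegrableOn w (tsupport g) volume := hw.integrableOn_compact_subset hgs hgc
  have h2 : IntegrableOn (fun x => g x • w x) (tsupport g) volume :=
    h1.continuousOn_smul hg.continuousOn hgc
  refine (integrableOn_iff_integrable_of_support_subset fun x hx => ?_).1 h2
  by_contra hc
  exact hx (by simp [image_eq_zero_of_notMem_tsupport hc])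

lemma HasWeakGradient.integral_mul_inner_gradient {w : EuclideanSpace ℝ (Fin N) → ℝ}
    {G : EuclideanSpace ℝ (Fin N) → EuclideanSpace ℝ (Fin N)} (h : HasWeakGradient Ω w G)
    {φ : EuclideanSpace ℝ (Fin N) → ℝ} (hφ : IsTestFunction ⊤ Ω φ)
    (v : EuclideanSpace ℝ (Fin N)) :
    ∫ x, w x * inner ℝ (gradient φ x) v = - ∫ x, inner ℝ (G x) v * φ x := by
  have hgc : Continuous (gradient φ) := hφ.contDiff_one.continuous_gradient
  have hcoord : ∀ i : Fin N, Continuous fun y : EuclideanSpace ℝ (Fin N) => y i := fun i => by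
    fun_prop
  have hsupp : ∀ i : Fin N, tsupport (fun x => gradient φ x i) ⊆ tsupport φ := fun i => by
    refine (closure_mono fun x hx => ?_).trans (tsupport_gradient_subset φ)
    rw [Function.mem_support] at hx ⊢
    intro h0
    exact hx (by simp [h0])
  have hcs : ∀ i : Fin N, HasCompactSupport fun x => gradient φ x i := fun i =>
    IsCompact.of_isClosed_subset hφ.2.1 (isClosed_tsupport _) (hsupp i)
  have i1 : ∀ i : Fin N, Integrable (fun x => w x * gradient φ x i) volume := fun i => by
    have := integrable_smul_of_locallyIntegrableOn h.1 ((hcoord i).comp hgc) (hcs i)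
      ((hsupp i).trans hφ.2.2)
    simpa [mul_comm] using this
  have i2 : ∀ i : Fin N, Integrable (fun x => G x i * φ x) volume := fun i => by
    have h2 := (EuclideanSpace.proj i : EuclideanSpace ℝ (Fin N) →L[ℝ] ℝ).integrable_comp
      (integrable_smul_of_locallyIntegrableOn h.2.1 hφ.1.continuous hφ.2.1 hφ.2.2)
    simpa [mul_comm] using h2
  have e : ∀ i : Fin N, ∫ x, w x * gradient φ x i = - ∫ x, G x i * φ x := fun i => by
    have := h.2.2 φ hφ i
    rwa [setIntegral_eq_integral_of_forall_compl_eq_zero,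
      setIntegral_eq_integral_of_forall_compl_eq_zero] at this
    · intro x hx
      simp [image_eq_zero_of_notMem_tsupport fun hc => hx (hφ.2.2 hc)]
    · intro x hx
      simp [gradient_eq_zero_of_notMem_tsupport fun hc => hx (hφ.2.2 hc)]
  calc ∫ x, w x * inner ℝ (gradient φ x) v
      = ∫ x, ∑ i, v i * (w x * gradient φ x i) := by
        refine integral_congr_ae (Eventually.of_forall fun x => ?_)
        simp only [PiLp.inner_apply, Finset.mul_sum]
        refine Finset.sum_congr rfl fun i _ => ?_
        simp; ring
    _ = - ∫ x, ∑ i, v i * (G x i * φ x) := by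
        rw [integral_finsetSum _ fun i _ => (i1 i).const_mul _,
          integral_finsetSum _ fun i _ => (i2 i).const_mul _, ← Finset.sum_neg_distrib]
        refine Finset.sum_congr rfl fun i _ => ?_
        rw [integral_const_mul, integral_const_mul, e i, mul_neg]
    _ = _ := by
        congr 1
        refine integral_congr_ae (Eventually.of_forall fun x => ?_)
        simp only [PiLp.inner_apply, Finset.sum_mul]
        refine Finset.sum_congr rfl fun i _ => ?_
        simp; ring

/-- The cutoff is `1` in a neighbourhood of `K`, hence its gradient vanishes on `K` and it leaves no
trace in integrals against functions supported there. -/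
lemma exists_cutoff {K : Set (EuclideanSpace ℝ (Fin N))} (hK : IsCompact K) (hΩ : IsOpen Ω)
    (hKΩ : K ⊆ Ω) : ∃ η : EuclideanSpace ℝ (Fin N) → ℝ, IsTestFunction ⊤ Ω η ∧
      (∀ x, 0 ≤ η x) ∧ (∀ x ∈ K, η x = 1) ∧ ∀ x ∈ K, gradient η x = 0 := by
  obtain ⟨L, hL, hKL, hLΩ⟩ := exists_compact_between hK hΩ hKΩ
  obtain ⟨f, h1, h2, h3⟩ := exists_contMDiffMap_one_nhds_of_subset_interior (n := ⊤)
    (modelWithCornersSelf ℝ (EuclideanSpace ℝ (Fin N))) hK.isClosed hKL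
  have hs : tsupport f ⊆ L := closure_minimal
    (fun x hx => by by_contra hc; exact hx (h2 x hc)) hL.isClosed
  have hev : ∀ x ∈ K, f =ᶠ[𝓝 x] fun _ => 1 := fun x hx =>
    h1.filter_mono (nhds_le_nhdsSet hx)
  refine ⟨f, ⟨f.contMDiff.contDiff, hL.of_isClosed_subset (isClosed_tsupport _) hs,
    hs.trans hLΩ⟩, fun x => (h3 x).1, fun x hx => (hev x hx).eq_of_nhds, fun x hx => ?_⟩
  rw [(hev x hx).gradient_eq, gradient_fun_const]

lemma memLp_smul_of_memL2Loc {F : Type*} [NormedAddCommGroup F] [NormedSpace ℝ F]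
    {g : EuclideanSpace ℝ (Fin N) → ℝ} {w : EuclideanSpace ℝ (Fin N) → F}
    (hw : MemL2Loc Ω w) (hg : Continuous g) (hgc : HasCompactSupport g)
    (hgs : tsupport g ⊆ Ω) : MemLp (fun x => g x • w x) 2 volume := by
  have h1 : MemLp ((tsupport g).indicator w) 2 volume :=
    (memLp_indicator_iff_restrict (isClosed_tsupport g).measurableSet).2 (hw _ hgc hgs)
  obtain ⟨C, hC⟩ := hgc.exists_bound_of_continuous hg
  have e : (fun x => g x • w x) = fun x => g x • (tsupport g).indicator w x := by
    ext1 x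
    by_cases hx : x ∈ tsupport g
    · simp [hx]
    · simp [image_eq_zero_of_notMem_tsupport hx]
  rw [e]
  refine MemLp.of_le_mul (c := C) h1 (hg.aestronglyMeasurable.smul h1.1) ?_
  filter_upwards with x
  rw [norm_smul]
  exact mul_le_mul_of_nonneg_right (hC x) (norm_nonneg _)

/-- The product rule holds weakly because `η φ` is a test function in `Ω` for any test function `φ`
on the whole space; mollification then supplies the approximation. -/
lemma MemH1Loc.h1Compact_mul (hΩ : IsOpen Ω) {w : EuclideanSpace ℝ (Fin N) → ℝ}
    {G : EuclideanSpace ℝ (Fin N) → EuclideanSpace ℝ (Fin N)} (h : MemH1Loc Ω w G)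
    {η : EuclideanSpace ℝ (Fin N) → ℝ} (hη : IsTestFunction ⊤ Ω η) :
    ∃ K : Set (EuclideanSpace ℝ (Fin N)), IsCompact K ∧ K ⊆ Ω ∧
      H1Compact K (fun x => η x * w x) (fun x => η x • G x + w x • gradient η x) := by
  obtain ⟨hwk, hw2, hG2⟩ := h
  obtain ⟨δ, hδ, hδΩ⟩ := IsCompact.exists_cthickening_subset_open hη.2.1 hΩ hη.2.2
  have hgc : Continuous (gradient η) := hη.contDiff_one.continuous_gradient
  have hgcs : HasCompactSupport (gradient η) :=
    IsCompact.of_isClosed_subset hη.2.1 (isClosed_tsupport _) (tsupport_gradient_subset η)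
  have hm1 : MemLp (fun x => η x * w x) 2 volume :=
    memLp_smul_of_memL2Loc hw2 hη.1.continuous hη.2.1 hη.2.2
  have hm2 : MemLp (fun x => η x • G x) 2 volume :=
    memLp_smul_of_memL2Loc hG2 hη.1.continuous hη.2.1 hη.2.2
  have hm3 : MemLp (fun x => w x • gradient η x) 2 volume := by
    have hind : MemLp ((tsupport η).indicator w) 2 volume :=
      (memLp_indicator_iff_restrict (isClosed_tsupport η).measurableSet).2 (hw2 _ hη.2.1 hη.2.2)
    obtain ⟨C, hC⟩ := hgcs.exists_bound_of_continuous hgc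
    have e : (fun x => w x • gradient η x) =
        fun x => (tsupport η).indicator w x • gradient η x := by
      ext1 x
      by_cases hx : x ∈ tsupport η
      · simp [hx]
      · simp [gradient_eq_zero_of_notMem_tsupport hx]
    rw [e]
    refine MemLp.of_le_mul (c := C) hind (hind.1.smul hgc.aestronglyMeasurable) ?_
    filter_upwards with x
    rw [norm_smul, mul_comm]
    exact mul_le_mul_of_nonneg_right (hC x) (norm_nonneg _)
  refine ⟨_, hη.2.1.cthickening, hδΩ, H1Compact.of_hasWeakGradient hη.2.1 hm1 (hm2.add hm3)
    (fun x hx => by simp [image_eq_zero_of_notMem_tsupport hx]) (fun φ hφ hφc v => ?_) hδ⟩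
  have hφ1 : ContDiff ℝ 1 φ := hφ.of_le (by exact_mod_cast le_top)
  have htest : IsTestFunction ⊤ Ω fun x => η x * φ x :=
    ⟨hη.1.mul hφ, hη.2.1.mul_right, (tsupport_mul_subset_left (f := η) (g := φ)).trans hη.2.2⟩
  have key := hwk.integral_mul_inner_gradient htest v
  have hgr : ∀ x, gradient (fun x => η x * φ x) x = η x • gradient φ x + φ x • gradient η x :=
    fun x => gradient_fun_mul (hη.contDiff_one.differentiable one_ne_zero x)
      (hφ1.differentiable one_ne_zero x)
  have hφ2 : MemLp φ 2 volume := memLp_of_tsupport_subset hφc.isCompact hφ1 subset_rfl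
  have hφg : MemLp (fun x => inner ℝ (gradient φ x) v) 2 volume :=
    (memLp_gradient_of_tsupport_subset hφc.isCompact hφ1 subset_rfl).inner_const v
  have j1 : Integrable (fun x => (η x * w x) * inner ℝ (gradient φ x) v) volume :=
    hm1.integrable_mul hφg
  have j2 : Integrable (fun x => inner ℝ (w x • gradient η x) v * φ x) volume :=
    (hm3.inner_const v).integrable_mul hφ2
  have j3 : Integrable (fun x => inner ℝ (η x • G x) v * φ x) volume :=
    (hm2.inner_const v).integrable_mul hφ2
  have e1 : ∫ x, w x * inner ℝ (gradient (fun x => η x * φ x) x) v =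
      (∫ x, (η x * w x) * inner ℝ (gradient φ x) v) +
        ∫ x, inner ℝ (w x • gradient η x) v * φ x := by
    rw [← integral_add j1 j2]
    refine integral_congr_ae (Eventually.of_forall fun x => ?_)
    simp only [hgr, inner_add_left, real_inner_smul_left]
    ring
  have e2 : ∫ x, inner ℝ (G x) v * (η x * φ x) = ∫ x, inner ℝ (η x • G x) v * φ x := by
    refine integral_congr_ae (Eventually.of_forall fun x => ?_)
    simp only [real_inner_smul_left]
    ring
  have e3 : ∫ x, inner ℝ (η x • G x + w x • gradient η x) v * φ x =
      (∫ x, inner ℝ (η x • G x) v * φ x) + ∫ x, inner ℝ (w x • gradient η x) v * φ x := by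
    rw [← integral_add j3 j2]
    refine integral_congr_ae (Eventually.of_forall fun x => ?_)
    simp only [inner_add_left, add_mul]
  rw [e1, e2] at key
  change _ = - ∫ x, inner ℝ (η x • G x + w x • gradient η x) v * φ x
  rw [e3]
  linarith

end Cutoff

/-! ### Enlarging the class of test functions. -/

section WeakSolution

variable {N : ℕ} {Ω : Set (EuclideanSpace ℝ (Fin N))} {β : ℝ}
  {f u v : EuclideanSpace ℝ (Fin N) → ℝ}
  {G Gu Gv H : EuclideanSpace ℝ (Fin N) → EuclideanSpace ℝ (Fin N)}

/-- `u` is a positive weak solution of `-Δu = f / u^β` in `Ω` with weak gradient `G`, without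
boundary condition. -/
def IsWeakSolution (β : ℝ) (Ω : Set (EuclideanSpace ℝ (Fin N)))
    (f u : EuclideanSpace ℝ (Fin N) → ℝ)
    (G : EuclideanSpace ℝ (Fin N) → EuclideanSpace ℝ (Fin N)) : Prop :=
  MemH1Loc Ω u G ∧ (∀ φ : EuclideanSpace ℝ (Fin N) → ℝ, IsTestFunction 1 Ω φ →
      ∫ x in Ω, inner ℝ (G x) (gradient φ x) = ∫ x in Ω, f x / u x ^ β * φ x) ∧
    LocallyEssPos Ω u

lemma IsWeakSolution.integrableOn (hβ : 0 < β) (hf : IntegrableOn f Ω volume)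
    (hu : IsWeakSolution β Ω f u G) {K : Set (EuclideanSpace ℝ (Fin N))} (hK : IsCompact K)
    (hKΩ : K ⊆ Ω) : IntegrableOn (fun x => f x / u x ^ β) K volume := by
  obtain ⟨c, hc, huc⟩ := hu.2.2 K hK hKΩ
  have hfK : IntegrableOn f K volume := hf.mono_set hKΩ
  have hum : AEMeasurable u (volume.restrict K) := (hu.1.2.1 K hK hKΩ).1.aemeasurable
  refine Integrable.mono' (hfK.norm.mul_const (c ^ β)⁻¹)
    (hfK.1.aemeasurable.div (hum.pow_const β)).aestronglyMeasurable ?_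
  filter_upwards [huc] with x hx
  have h1 : c ^ β ≤ u x ^ β := Real.rpow_le_rpow hc.le hx hβ.le
  have h2 : 0 < c ^ β := Real.rpow_pos_of_pos hc β
  rw [norm_div, div_eq_mul_inv, Real.norm_of_nonneg (h2.le.trans h1)]
  gcongr

/-- Each point has a compact neighbourhood in `Ω` on which `u` is essentially bounded below, and a
set that is locally null is null. -/
lemma LocallyEssPos.ae_pos (hΩ : IsOpen Ω) (hu : LocallyEssPos Ω u) :
    ∀ᵐ x ∂(volume.restrict Ω), 0 < u x := by
  have hloc : ∀ x ∈ Ω, ∃ s ∈ 𝓝[Ω] x, volume {y | y ∈ s ∧ ¬ 0 < u y} = 0 := fun x hx => by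
    obtain ⟨L, hL, hxL, hLΩ⟩ := exists_compact_between isCompact_singleton hΩ
      (Set.singleton_subset_iff.2 hx)
    obtain ⟨c, hc, hcu⟩ := hu L hL hLΩ
    refine ⟨L, mem_nhdsWithin_of_mem_nhds (mem_interior_iff_mem_nhds.1 (hxL rfl)), ?_⟩
    rw [ae_restrict_iff' hL.measurableSet] at hcu
    refine measure_mono_null ?_ (ae_iff.1 hcu)
    exact fun y hy hcon => hy.2 (hc.trans_le (hcon hy.1))
  rw [ae_restrict_iff' hΩ.measurableSet]
  have hz : volume {y | y ∈ Ω ∧ ¬ 0 < u y} = 0 := by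
    refine measure_null_of_locally_null _ fun x hx => ?_
    obtain ⟨s, hs, hs0⟩ := hloc x hx.1
    refine ⟨s ∩ {y | y ∈ Ω ∧ ¬ 0 < u y}, ?_, measure_mono_null ?_ hs0⟩
    swap
    · exact fun y hy => ⟨hy.1, hy.2.2⟩
    exact inter_mem (nhdsWithin_mono x (fun y hy => hy.1) hs) self_mem_nhdsWithin
  refine measure_mono_null (fun y hy => ?_) hz
  simpa [Classical.not_imp] using hy

/-- Since `f / u ^ β` is only locally integrable, a general `H¹` function cannot be used as a test
function. A bounded function `F` of it can: the left side passes to the limit in `L²`, the right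
side by dominated convergence. -/
lemma IsWeakSolution.integral_inner_comp (hΩ : MeasurableSet Ω) (hβ : 0 < β)
    (hf : IntegrableOn f Ω volume)
    (hu : IsWeakSolution β Ω f u G) {K : Set (EuclideanSpace ℝ (Fin N))} (hK : IsCompact K)
    (hKΩ : K ⊆ Ω) {w : EuclideanSpace ℝ (Fin N) → ℝ} (hw : H1Compact K w H) {F : ℝ → ℝ}
    (hF : ContDiff ℝ 1 F) (hF0 : F 0 = 0) {C M : ℝ} (hC : ∀ t, |deriv F t| ≤ C)
    (hM : ∀ t, |F t| ≤ M) :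
    ∫ x in K, inner ℝ (G x) (deriv F (w x) • H x) = ∫ x in K, f x / u x ^ β * F (w x) := by
  obtain ⟨φ, h1, h2, h3, h4, h5⟩ := hw.exists_seq
  obtain ⟨m1, m2, t1, t2⟩ := hw.tendsto_comp h1 h3 h4 h5 hF hF0 hC
  have hc := fun n => contDiff_comp_of_tsupport (h1 n) (h2 n) hF hF0
  have hint := hu.integrableOn hβ hf hK hKΩ
  have e : ∀ n, ∫ x in K, inner ℝ (gradient (fun x => F (φ n x)) x) (G x) =
      ∫ x in K, f x / u x ^ β * F (φ n x) := fun n => by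
    have h := hu.2.1 (fun x => F (φ n x)) ⟨(hc n).1,
      hK.of_isClosed_subset (isClosed_tsupport _) (hc n).2, (hc n).2.trans hKΩ⟩
    rw [setIntegral_eq_of_subset_of_forall_sdiff_eq_zero hΩ hKΩ,
      setIntegral_eq_of_subset_of_forall_sdiff_eq_zero hΩ hKΩ] at h
    · simp_rw [real_inner_comm (G _)]
      exact h
    · intro x hx
      rw [image_eq_zero_of_notMem_tsupport fun hc' => hx.2 ((hc n).2 hc'), mul_zero]
    · intro x hx
      rw [gradient_eq_zero_of_notMem_tsupport fun hc' => hx.2 ((hc n).2 hc'), inner_zero_right]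
  have l1 := tendsto_integral_inner_left (μ := volume.restrict K)
    (f := fun n => gradient (fun x => F (φ n x))) (f₀ := fun x => deriv F (w x) • H x) (g := G)
    (fun n => (memLp_gradient_of_tsupport_subset hK (hc n).1 (hc n).2).restrict K)
    (m2.restrict K) (hu.1.2.2 K hK hKΩ)
    (tendsto_of_tendsto_of_tendsto_of_le_of_le tendsto_const_nhds t2 (fun _ => zero_le)
      fun n => eLpNorm_restrict_le _ _ _ _)
  have l2 : Tendsto (fun n => ∫ x in K, f x / u x ^ β * F (φ n x)) atTop
      (𝓝 (∫ x in K, f x / u x ^ β * F (w x))) := by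
    refine tendsto_integral_of_dominated_convergence (fun x => ‖f x / u x ^ β‖ * M)
      (fun n => hint.1.mul (hF.continuous.comp (h1 n).continuous).aestronglyMeasurable)
      (hint.norm.mul_const M) (fun n => Eventually.of_forall fun x => ?_) ?_
    · rw [norm_mul]
      exact mul_le_mul_of_nonneg_left (hM _) (norm_nonneg _)
    · filter_upwards [ae_restrict_of_ae h5] with x hx
      exact ((hF.continuous.tendsto _).comp hx).const_mul _
  simp_rw [e] at l1
  have := tendsto_nhds_unique l1 l2
  simpa only [real_inner_comm (G _)] using this

/-- A smooth truncation of the identity at height comparable to `n`. -/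
noncomputable def arctanTrunc (n : ℕ) (t : ℝ) : ℝ := ((n : ℝ) + 1) * Real.arctan (t / ((n : ℝ) + 1))

lemma arctanTrunc_props (n : ℕ) : ContDiff ℝ 1 (arctanTrunc n) ∧ arctanTrunc n 0 = 0 ∧
    (∀ t, deriv (arctanTrunc n) t = 1 / (1 + (t / ((n : ℝ) + 1)) ^ 2)) ∧
    (∀ t, |deriv (arctanTrunc n) t| ≤ 1) ∧
    (∀ t, |arctanTrunc n t| ≤ ((n : ℝ) + 1) * (Real.pi / 2)) ∧
    ∀ t, 0 ≤ t → 0 ≤ arctanTrunc n t := by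
  have hn : (0 : ℝ) < (n : ℝ) + 1 := by positivity
  have hd : ∀ t, deriv (arctanTrunc n) t = 1 / (1 + (t / ((n : ℝ) + 1)) ^ 2) := fun t => by
    have h := (((hasDerivAt_id t).div_const ((n : ℝ) + 1)).arctan).const_mul ((n : ℝ) + 1)
    rw [show deriv (arctanTrunc n) t = _ from h.deriv]
    simp only [id]
    field_simp
  refine ⟨?_, by simp [arctanTrunc], hd, fun t => ?_, fun t => ?_, fun t ht => ?_⟩
  · exact contDiff_const.mul (Real.contDiff_arctan.comp (contDiff_id.div_const _))
  · rw [hd, abs_of_nonneg (by positivity)]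
    exact div_le_one_of_le₀ (by nlinarith [sq_nonneg (t / ((n : ℝ) + 1))]) (by positivity)
  · rw [arctanTrunc, abs_mul, abs_of_pos hn]
    gcongr
    exact abs_le.2 ⟨(Real.neg_pi_div_two_lt_arctan _).le, (Real.arctan_lt_pi_div_two _).le⟩
  · exact mul_nonneg hn.le (Real.arctan_nonneg.2 (div_nonneg ht hn.le))

/-- This removes the truncation on the gradient side only. On the side of `f` just the sign of the
integral is retained, so integrability of `f / u ^ β * w` is never needed. -/
lemma tendsto_integral_deriv_arctanTrunc {K : Set (EuclideanSpace ℝ (Fin N))}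
    {w : EuclideanSpace ℝ (Fin N) → ℝ} (hw : H1Compact K w H)
    (hG : MemLp G 2 (volume.restrict K)) :
    Tendsto (fun n => ∫ x in K, inner ℝ (G x) (deriv (arctanTrunc n) (w x) • H x)) atTop
      (𝓝 (∫ x in K, inner ℝ (G x) (H x))) := by
  have hint := MemLp.integrable_inner_two hG (hw.2.1.restrict K)
  refine tendsto_integral_of_dominated_convergence (fun x => ‖inner ℝ (G x) (H x)‖)
    (fun n => ?_) hint.norm (fun n => Eventually.of_forall fun x => ?_)
    (Eventually.of_forall fun x => ?_)
  · have hm : AEStronglyMeasurable (fun x => deriv (arctanTrunc n) (w x) • H x) volume :=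
      (((arctanTrunc_props n).1.continuous_deriv le_rfl).comp_aestronglyMeasurable hw.1.1).smul
        hw.2.1.1
    exact hG.1.inner hm.restrict
  · rw [inner_smul_right, norm_mul]
    exact mul_le_of_le_one_left (norm_nonneg _) ((arctanTrunc_props n).2.2.2.1 _)
  · simp_rw [inner_smul_right, (arctanTrunc_props _).2.2.1]
    have h1 : Tendsto (fun n : ℕ => w x / ((n : ℝ) + 1)) atTop (𝓝 0) := by
      have := tendsto_one_div_add_atTop_nhds_zero_nat (𝕜 := ℝ) |>.const_mul (w x)
      simpa [div_eq_mul_inv] using this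
    have h2 : Tendsto (fun n : ℕ => 1 / (1 + (w x / ((n : ℝ) + 1)) ^ 2)) atTop
        (𝓝 (1 / (1 + (0 : ℝ) ^ 2))) :=
      tendsto_const_nhds.div (tendsto_const_nhds.add (h1.pow 2)) (by norm_num)
    simpa using h2.mul_const (inner ℝ (G x) (H x))

lemma IsWeakSolution.integral_inner_nonneg (hΩ : MeasurableSet Ω) (hβ : 0 < β)
    (hf : IntegrableOn f Ω volume)
    (hf0 : ∀ᵐ x ∂(volume.restrict Ω), 0 ≤ f x)
    (hu : IsWeakSolution β Ω f u G) {K : Set (EuclideanSpace ℝ (Fin N))} (hK : IsCompact K)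
    (hKΩ : K ⊆ Ω) {w : EuclideanSpace ℝ (Fin N) → ℝ} (hw : H1Compact K w H)
    (hw0 : ∀ x, 0 ≤ w x) : 0 ≤ ∫ x in K, inner ℝ (G x) (H x) := by
  refine ge_of_tendsto' (tendsto_integral_deriv_arctanTrunc hw (hu.1.2.2 K hK hKΩ)) fun n => ?_
  obtain ⟨p1, p2, -, p4, p5, p6⟩ := arctanTrunc_props n
  rw [hu.integral_inner_comp hΩ hβ hf hK hKΩ hw p1 p2 p4 p5]
  obtain ⟨c, hc, huc⟩ := hu.2.2 K hK hKΩ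
  refine integral_nonneg_of_ae ?_
  filter_upwards [huc, ae_mono (Measure.restrict_mono hKΩ le_rfl) hf0] with x h1 h2
  exact mul_nonneg (div_nonneg h2 (Real.rpow_nonneg (hc.le.trans h1) β)) (p6 _ (hw0 x))

/-- Monotonicity of the singular term: where the test function is positive, `v ≤ u` gives `f / u ^ β
≤ f / v ^ β`. The truncation preserves signs and is removed at the end. -/
lemma IsWeakSolution.integral_inner_sub_nonpos (hΩ : MeasurableSet Ω) (hβ : 0 < β)
    (hf : IntegrableOn f Ω volume)
    (hf0 : ∀ᵐ x ∂(volume.restrict Ω), 0 ≤ f x)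
    (hu : IsWeakSolution β Ω f u Gu) (hv : IsWeakSolution β Ω f v Gv)
    {K : Set (EuclideanSpace ℝ (Fin N))} (hK : IsCompact K)
    (hKΩ : K ⊆ Ω) {w : EuclideanSpace ℝ (Fin N) → ℝ} (hw : H1Compact K w H)
    (hw0 : ∀ x, 0 ≤ w x) (hwuv : ∀ x, 0 < w x → v x ≤ u x) :
    ∫ x in K, inner ℝ (Gu x - Gv x) (H x) ≤ 0 := by
  have hGu := hu.1.2.2 K hK hKΩ
  have hGv := hv.1.2.2 K hK hKΩ
  refine le_of_tendsto' (tendsto_integral_deriv_arctanTrunc hw (hGu.sub hGv)) fun n => ?_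
  obtain ⟨p1, p2, -, p4, p5, p6⟩ := arctanTrunc_props n
  have m := (hw.comp hK p1 p2 p4).2.1.restrict K
  simp only [inner_sub_left]
  rw [integral_sub (MemLp.integrable_inner_two hGu m) (MemLp.integrable_inner_two hGv m),
    hu.integral_inner_comp hΩ hβ hf hK hKΩ hw p1 p2 p4 p5,
    hv.integral_inner_comp hΩ hβ hf hK hKΩ hw p1 p2 p4 p5, sub_nonpos]
  obtain ⟨c, hc, hvc⟩ := hv.2.2 K hK hKΩ
  have hb : ∀ {z : EuclideanSpace ℝ (Fin N) → ℝ}, IntegrableOn z K volume →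
      IntegrableOn (fun x => z x * arctanTrunc n (w x)) K volume := fun {z} hz => by
    refine Integrable.mul_bdd (c := ((n : ℝ) + 1) * (Real.pi / 2)) hz ?_
      (Eventually.of_forall fun x => p5 _)
    exact (p1.continuous.comp_aestronglyMeasurable hw.1.1).restrict
  refine integral_mono_ae (hb (hu.integrableOn hβ hf hK hKΩ)) (hb (hv.integrableOn hβ hf hK hKΩ)) ?_
  filter_upwards [hvc, ae_mono (Measure.restrict_mono hKΩ le_rfl) hf0] with x h1 h2
  rcases (hw0 x).eq_or_lt with h | h
  · simp [← h, p2]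
  · have h3 : v x ^ β ≤ u x ^ β := Real.rpow_le_rpow (hc.le.trans h1) (hwuv x h) hβ.le
    have h4 : 0 < v x ^ β := Real.rpow_pos_of_pos (hc.trans_le h1) β
    exact mul_le_mul_of_nonneg_right (div_le_div_of_nonneg_left h2 h4 h3) (p6 _ (hw0 x))

end WeakSolution

/-! ### The comparison principle and uniqueness. -/

section Comparison

variable {N : ℕ} {Ω : Set (EuclideanSpace ℝ (Fin N))} {β : ℝ}
  {f u v : EuclideanSpace ℝ (Fin N) → ℝ}
  {G Gu Gv H : EuclideanSpace ℝ (Fin N) → EuclideanSpace ℝ (Fin N)}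

lemma IsTestFunction.h1Compact {K : Set (EuclideanSpace ℝ (Fin N))} (hK : IsCompact K)
    {φ : EuclideanSpace ℝ (Fin N) → ℝ} (hφ : IsTestFunction ⊤ Ω φ) (h : tsupport φ ⊆ K) :
    H1Compact K φ (gradient φ) :=
  H1Compact.of_contDiff hK hφ.contDiff_one h

lemma ae_eq_of_integral_inner_eq (hΩ : IsOpen Ω) (hG : LocallyIntegrableOn G Ω volume)
    (hH : LocallyIntegrableOn H Ω volume)
    (h : ∀ φ : EuclideanSpace ℝ (Fin N) → ℝ, IsTestFunction ⊤ Ω φ → ∀ e,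
      ∫ x, inner ℝ (G x) e * φ x = ∫ x, inner ℝ (H x) e * φ x) :
    ∀ᵐ x ∂(volume.restrict Ω), G x = H x := by
  have key := hΩ.ae_eq_zero_of_integral_contDiff_smul_eq_zero (μ := volume) (f := G - H)
    (hG.sub hH) fun φ h1 h2 h3 => ?_
  · rw [ae_restrict_iff' hΩ.measurableSet]
    filter_upwards [key] with x hx hxΩ
    exact sub_eq_zero.1 (hx hxΩ)
  · have i1 := integrable_smul_of_locallyIntegrableOn hG h1.continuous h2 h3
    have i2 := integrable_smul_of_locallyIntegrableOn hH h1.continuous h2 h3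
    simp only [Pi.sub_apply, smul_sub]
    rw [integral_sub i1 i2, sub_eq_zero]
    refine ext_inner_left ℝ fun e => ?_
    rw [← integral_inner (𝕜 := ℝ) i1, ← integral_inner (𝕜 := ℝ) i2]
    simpa [inner_smul_right, real_inner_comm, mul_comm] using h φ ⟨h1, h2, h3⟩ e

/-- The gradient provided by membership in `H¹₀` is a priori unrelated to `Gu`. Near the support of
a test function, `(η u - ε η)⁺` has the same values as `(u - ε)⁺`, and its gradient is known from
the positive part rule; uniqueness of weak gradients does the rest. -/
lemma gradient_posPart_sub_const (hΩ : IsOpen Ω) (hu : MemH1Loc Ω u Gu) {ε : ℝ}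
    (hG : HasWeakGradient Ω (fun x => max (u x - ε) 0) G) :
    ∀ᵐ x ∂(volume.restrict Ω), G x = {x | ε < u x}.indicator Gu x := by
  have hum : AEStronglyMeasurable u (volume.restrict Ω) := hu.1.1.aestronglyMeasurable
  have hset : NullMeasurableSet {x | ε < u x} (volume.restrict Ω) :=
    nullMeasurableSet_lt aemeasurable_const hum.aemeasurable
  have hloc : LocallyIntegrableOn ({x | ε < u x}.indicator Gu) Ω volume := by
    intro x hx
    obtain ⟨s, hs, hsi⟩ := hu.1.2.1 x hx
    refine ⟨s ∩ Ω, inter_mem hs self_mem_nhdsWithin, ?_⟩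
    refine Integrable.mono (hsi.mono_set Set.inter_subset_left) ?_
      (Eventually.of_forall fun x => norm_indicator_le_norm_self _ _)
    exact (hu.1.2.1.aestronglyMeasurable.indicator₀ hset).mono_measure
      (Measure.restrict_mono Set.inter_subset_right le_rfl)
  refine ae_eq_of_integral_inner_eq hΩ hG.2.1 hloc fun φ hφ e => ?_
  have h1 := hG.integral_mul_inner_gradient hφ e
  obtain ⟨η, hη, -, hη1, hηg⟩ := exists_cutoff hφ.2.1 hΩ hφ.2.2
  obtain ⟨K, hK, hKΩ, hKu⟩ := hu.h1Compact_mul hΩ hη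
  have hce : IsTestFunction ⊤ Ω fun x => ε * η x :=
    ⟨contDiff_const.mul hη.1, hη.2.1.mul_left,
      (tsupport_mul_subset_right (f := fun _ => ε) (g := η)).trans hη.2.2⟩
  have hL : IsCompact (K ∪ tsupport fun x => ε * η x) := hK.union hce.2.1
  have h2 := ((hKu.mono Set.subset_union_left).sub
    (hce.h1Compact hL Set.subset_union_right)).posPart hL
  have h3 := h2.integral_mul_gradient hL hφ.contDiff_one hφ.2.1 e
  have hgc : ∀ x ∈ tsupport φ, gradient (fun x => ε * η x) x = 0 := fun x hx => by
    rw [gradient_fun_mul (differentiableAt_const _)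
      (hη.contDiff_one.differentiable one_ne_zero x), hηg x hx]
    simp
  have e1 : ∀ x, max (((fun x => η x * u x) - fun x => ε * η x) x) 0 * inner ℝ (gradient φ x) e =
      max (u x - ε) 0 * inner ℝ (gradient φ x) e := fun x => by
    by_cases hx : x ∈ tsupport φ
    · simp [hη1 x hx]
    · simp [gradient_eq_zero_of_notMem_tsupport hx]
  have e2 : ∀ x, inner ℝ ({x | 0 < ((fun x => η x * u x) - fun x => ε * η x) x}.indicator
      ((fun x => η x • Gu x + u x • gradient η x) - gradient fun x => ε * η x) x) e * φ x =
      inner ℝ ({x | ε < u x}.indicator Gu x) e * φ x := fun x => by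
    by_cases hx : x ∈ tsupport φ
    · simp only [Set.indicator_apply, Set.mem_ofPred_eq, Pi.sub_apply, hη1 x hx, hηg x hx, hgc x hx]
      simp
    · simp [image_eq_zero_of_notMem_tsupport hx]
  simp_rw [e1, e2] at h3
  rw [h1, neg_inj] at h3
  exact h3

/-- Testing the supersolution inequality with `(φ - v)⁺` gives `0 ≤ ∫ ∇v · (∇φ - ∇v)` over `{v <
φ}`, and Young's inequality concludes. Because `v > 0`, the set `{v < φ}` lies in the support of `φ`
up to a null set, so the bound holds on all of `Ω` whatever `v` does at the boundary. -/
lemma IsWeakSolution.lintegral_gradient_le (hΩ : IsOpen Ω) (hβ : 0 < β)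
    (hf : IntegrableOn f Ω volume) (hf0 : ∀ᵐ x ∂(volume.restrict Ω), 0 ≤ f x)
    (hv : IsWeakSolution β Ω f v Gv)
    {φ : EuclideanSpace ℝ (Fin N) → ℝ} (hφ : IsTestFunction ⊤ Ω φ) :
    ∫⁻ x in Ω, ‖{x | v x < φ x}.indicator Gv x‖ₑ ^ 2 ≤ ∫⁻ x in Ω, ‖gradient φ x‖ₑ ^ 2 := by
  have hvpos := hv.2.2.ae_pos hΩ
  obtain ⟨η, hη, hη0, hη1, hηg⟩ := exists_cutoff hφ.2.1 hΩ hφ.2.2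
  obtain ⟨K₀, hK₀, hK₀Ω, hKv⟩ := hv.1.h1Compact_mul hΩ hη
  set K := K₀ ∪ tsupport φ with hKdef
  have hK : IsCompact K := hK₀.union hφ.2.1
  have hKΩ : K ⊆ Ω := Set.union_subset hK₀Ω hφ.2.2
  have hw := ((hφ.h1Compact hK Set.subset_union_right).sub
    (hKv.mono Set.subset_union_left)).posPart hK
  have h0 := hv.integral_inner_nonneg hΩ.measurableSet hβ hf hf0 hK hKΩ hw
    (fun x => le_max_right _ _)
  set S : Set (EuclideanSpace ℝ (Fin N)) := {x | v x < φ x} with hS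
  have hvm : AEStronglyMeasurable v (volume.restrict K) := (hv.1.2.1 K hK hKΩ).1
  have hSm : NullMeasurableSet S (volume.restrict K) :=
    nullMeasurableSet_lt hvm.aemeasurable hφ.1.continuous.aemeasurable
  have hGv : MemLp Gv 2 (volume.restrict K) := hv.1.2.2 K hK hKΩ
  have hI : MemLp (S.indicator Gv) 2 (volume.restrict K) :=
    hGv.mono (hGv.1.indicator₀ hSm) (Eventually.of_forall fun x => norm_indicator_le_norm_self _ _)
  have hg : MemLp (gradient φ) 2 (volume.restrict K) :=
    (memLp_gradient_of_tsupport_subset hK hφ.contDiff_one Set.subset_union_right).restrict K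
  have hpt : ∀ᵐ x ∂(volume.restrict K), inner ℝ (Gv x) 
      ({x | 0 < (φ - fun x => η x * v x) x}.indicator
      (gradient φ - fun x => η x • Gv x + v x • gradient η x) x) =
      inner ℝ (S.indicator Gv x) (gradient φ x) - ‖S.indicator Gv x‖ ^ 2 := by
    filter_upwards [ae_mono (Measure.restrict_mono hKΩ le_rfl) hvpos] with x hx
    by_cases hxφ : x ∈ tsupport φ
    · by_cases hxS : v x < φ x
      · simp [S, hxS, hη1 x hxφ, hηg x hxφ, inner_sub_right]
      · simp [S, hxS, hη1 x hxφ]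
    -- Away from the support of `φ` the cutoff is uncontrolled, but `η ≥ 0` and `v > 0` make the
    -- positive part vanish.
    · have h1 : φ x = 0 := image_eq_zero_of_notMem_tsupport hxφ
      have h2 : ¬ (η x * v x < 0) := not_lt.2 (mul_nonneg (hη0 x) hx.le)
      simp [S, h1, h2, hx.not_gt, gradient_eq_zero_of_notMem_tsupport hxφ]
  rw [integral_congr_ae hpt] at h0
  have I1 : Integrable (fun x => ‖S.indicator Gv x‖ ^ 2) (volume.restrict K) :=
    hI.norm.integrable_sq
  have I2 : Integrable (fun x => ‖gradient φ x‖ ^ 2) (volume.restrict K) := hg.norm.integrable_sq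
  have hle : ∫ x in K, ‖S.indicator Gv x‖ ^ 2 ≤ ∫ x in K, ‖gradient φ x‖ ^ 2 := by
    have h3 : ∫ x in K, (inner ℝ (S.indicator Gv x) (gradient φ x) - ‖S.indicator Gv x‖ ^ 2) ≤
        ∫ x in K, (1 / 2 * ‖gradient φ x‖ ^ 2 - 1 / 2 * ‖S.indicator Gv x‖ ^ 2) := by
      refine integral_mono ((MemLp.integrable_inner_two hI hg).sub I1)
        ((I2.const_mul _).sub (I1.const_mul _)) fun x => ?_
      have h4 := real_inner_le_norm (S.indicator Gv x) (gradient φ x)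
      have h5 := sq_nonneg (‖S.indicator Gv x‖ - ‖gradient φ x‖)
      simp only
      nlinarith
    rw [integral_sub (I2.const_mul _) (I1.const_mul _), integral_const_mul,
      integral_const_mul] at h3
    linarith
  have c : ∀ g : EuclideanSpace ℝ (Fin N) → EuclideanSpace ℝ (Fin N),
      Integrable (fun x => ‖g x‖ ^ 2) (volume.restrict K) →
      ∫⁻ x in K, ‖g x‖ₑ ^ 2 = ENNReal.ofReal (∫ x in K, ‖g x‖ ^ 2) := fun g hg => by
    rw [ofReal_integral_eq_lintegral_ofReal hg (Eventually.of_forall fun x => sq_nonneg _)]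
    refine lintegral_congr fun x => ?_
    rw [← ofReal_norm, ← ENNReal.ofReal_pow (norm_nonneg _)]
  have hΩK : ∫⁻ x in Ω, ‖S.indicator Gv x‖ₑ ^ 2 = ∫⁻ x in K, ‖S.indicator Gv x‖ₑ ^ 2 := by
    rw [← Set.inter_eq_self_of_subset_left hKΩ, ← setLIntegral_indicator hK.measurableSet]
    refine lintegral_congr_ae ?_
    filter_upwards [hvpos] with x hx
    by_cases hxK : x ∈ K
    · simp [hxK]
    · have h1 : φ x = 0 := image_eq_zero_of_notMem_tsupport fun hc => hxK (Or.inr hc)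
      simp [hxK, S, h1, hx.not_gt]
  rw [hΩK, c _ I1]
  refine (ENNReal.ofReal_le_ofReal hle).trans ?_
  rw [← c _ I2]
  exact lintegral_mono_set hKΩ

/-- A sequence of test functions approximating an element of `H¹₀(Ω)` also almost everywhere. -/
lemma exists_testFunction_seq {w : EuclideanSpace ℝ (Fin N) → ℝ} (hw : MemH10 Ω w) :
    ∃ G : EuclideanSpace ℝ (Fin N) → EuclideanSpace ℝ (Fin N), HasWeakGradient Ω w G ∧
      MemLp w 2 (volume.restrict Ω) ∧ MemLp G 2 (volume.restrict Ω) ∧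
      ∃ φ : ℕ → EuclideanSpace ℝ (Fin N) → ℝ, (∀ n, IsTestFunction ⊤ Ω (φ n)) ∧
        Tendsto (fun n => eLpNorm (gradient (φ n) - G) 2 (volume.restrict Ω)) atTop (𝓝 0) ∧
        ∀ᵐ x ∂(volume.restrict Ω), Tendsto (fun n => φ n x) atTop (𝓝 (w x)) := by
  obtain ⟨G, h1, h2, h3, φ, h4, h5, h6⟩ := hw
  obtain ⟨ns, hns, hae⟩ := exists_seq_tendsto_ae_of_eLpNorm
    (fun n => (h4 n).1.continuous.aestronglyMeasurable) h2.1 h5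
  exact ⟨G, h1, h2, h3, fun n => φ (ns n), fun n => h4 _, h6.comp hns.tendsto_atTop, hae⟩

/-- The bounds for `φₙ` are uniform since the gradients converge, and Fatou transfers them: at
almost every point with `v < w` one eventually has `v < φₙ`. -/
lemma IsWeakSolution.memLp_indicator_gradient (hΩ : IsOpen Ω) (hβ : 0 < β)
    (hf : IntegrableOn f Ω volume) (hf0 : ∀ᵐ x ∂(volume.restrict Ω), 0 ≤ f x)
    (hv : IsWeakSolution β Ω f v Gv) {w : EuclideanSpace ℝ (Fin N) → ℝ}
    (hwm : AEStronglyMeasurable w (volume.restrict Ω)) (hG : MemLp G 2 (volume.restrict Ω))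
    {φ : ℕ → EuclideanSpace ℝ (Fin N) → ℝ} (hφ : ∀ n, IsTestFunction ⊤ Ω (φ n))
    (hgr : Tendsto (fun n => eLpNorm (gradient (φ n) - G) 2 (volume.restrict Ω)) atTop (𝓝 0))
    (hae : ∀ᵐ x ∂(volume.restrict Ω), Tendsto (fun n => φ n x) atTop (𝓝 (w x))) :
    MemLp ({x | v x < w x}.indicator Gv) 2 (volume.restrict Ω) := by
  have hvm : AEStronglyMeasurable v (volume.restrict Ω) := hv.1.1.1.aestronglyMeasurable
  have hGm : AEStronglyMeasurable Gv (volume.restrict Ω) := hv.1.1.2.1.aestronglyMeasurable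
  have hm : ∀ {z : EuclideanSpace ℝ (Fin N) → ℝ}, AEStronglyMeasurable z (volume.restrict Ω) →
      AEStronglyMeasurable ({x | v x < z x}.indicator Gv) (volume.restrict Ω) := fun hz =>
    hGm.indicator₀ (nullMeasurableSet_lt hvm.aemeasurable hz.aemeasurable)
  have hmn := fun n => hm (hφ n).1.continuous.aestronglyMeasurable
  refine ⟨hm hwm, ?_⟩
  have hev : ∀ᶠ n in atTop,
      ∫⁻ x in Ω, ‖{x | v x < φ n x}.indicator Gv x‖ₑ ^ 2 ≤
        (1 + eLpNorm G 2 (volume.restrict Ω)) ^ 2 := by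
    filter_upwards [hgr.eventually_le_const zero_lt_one] with n hn
    refine (hv.lintegral_gradient_le hΩ hβ hf hf0 (hφ n)).trans ?_
    rw [← eLpNorm_two_sq]
    gcongr
    calc eLpNorm (gradient (φ n)) 2 (volume.restrict Ω)
        = eLpNorm (gradient (φ n) - G + G) 2 (volume.restrict Ω) := by rw [sub_add_cancel]
      _ ≤ _ := eLpNorm_add_le
          ((hφ n).contDiff_one.continuous_gradient.aestronglyMeasurable.sub hG.1) hG.1
          (by norm_num)
      _ ≤ _ := by gcongr
  have hfatou : ∫⁻ x in Ω, ‖{x | v x < w x}.indicator Gv x‖ₑ ^ 2 ≤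
      (1 + eLpNorm G 2 (volume.restrict Ω)) ^ 2 := by
    calc _ ≤ ∫⁻ x in Ω, liminf (fun n => ‖{x | v x < φ n x}.indicator Gv x‖ₑ ^ 2) atTop := by
          refine lintegral_mono_ae ?_
          filter_upwards [hae] with x hx
          by_cases h : v x < w x
          · have : Tendsto (fun n => ‖{x | v x < φ n x}.indicator Gv x‖ₑ ^ 2) atTop
                (𝓝 (‖{x | v x < w x}.indicator Gv x‖ₑ ^ 2)) := by
              refine tendsto_const_nhds.congr' ?_
              filter_upwards [hx.eventually_const_lt h] with n hn
              simp [h, hn]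
            exact this.liminf_eq.ge
          · simp [h]
      _ ≤ liminf (fun n => ∫⁻ x in Ω, ‖{x | v x < φ n x}.indicator Gv x‖ₑ ^ 2) atTop :=
          lintegral_liminf_le' fun n => (hmn n).enorm.pow_const 2
      _ ≤ _ := liminf_le_of_frequently_le' hev.frequently
  rw [← eLpNorm_two_sq] at hfatou
  by_contra hc
  rw [not_lt_top_iff.1 hc] at hfatou
  have : (1 + eLpNorm G 2 (volume.restrict Ω)) ^ 2 < ∞ :=
    ENNReal.pow_lt_top (ENNReal.add_lt_top.2 ⟨ENNReal.one_lt_top, hG.2⟩)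
  simpa using hfatou.trans_lt this

/-- The gradient of `min φ⁺ W`, where `W = (u - v - ε)⁺`. -/
noncomputable def minGradient (φ W : EuclideanSpace ℝ (Fin N) → ℝ)
    (Gu Gv : EuclideanSpace ℝ (Fin N) → EuclideanSpace ℝ (Fin N)) :
    EuclideanSpace ℝ (Fin N) → EuclideanSpace ℝ (Fin N) :=
  {x | 0 < φ x ∧ φ x ≤ W x}.indicator (gradient φ) + {x | 0 < W x ∧ W x < φ x}.indicator (Gu - Gv)

/-- From `min a b = a - (a - b)⁺` only differences and positive parts are needed. They are applied
to `η u - η v - ε η`, which is compactly supported and agrees with `u - v - ε` on the support of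
`φ`; elsewhere the minimum is zero. -/
lemma h1Compact_min (hΩ : IsOpen Ω) (hu : MemH1Loc Ω u Gu) (hv : MemH1Loc Ω v Gv) {ε : ℝ}
    {φ : EuclideanSpace ℝ (Fin N) → ℝ} (hφ : IsTestFunction ⊤ Ω φ) :
    ∃ K, IsCompact K ∧ K ⊆ Ω ∧ tsupport φ ⊆ K ∧
      H1Compact K (fun x => min (max (φ x) 0) (max (u x - v x - ε) 0))
      (minGradient φ (fun x => max (u x - v x - ε) 0) Gu Gv) := by
  obtain ⟨η, hη, hη0, hη1, hηg⟩ := exists_cutoff hφ.2.1 hΩ hφ.2.2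
  obtain ⟨K₁, hK₁, hK₁Ω, hKu⟩ := hu.h1Compact_mul hΩ hη
  obtain ⟨K₂, hK₂, hK₂Ω, hKv⟩ := hv.h1Compact_mul hΩ hη
  have hce : IsTestFunction ⊤ Ω fun x => ε * η x :=
    ⟨contDiff_const.mul hη.1, hη.2.1.mul_left,
      (tsupport_mul_subset_right (f := fun _ => ε) (g := η)).trans hη.2.2⟩
  set K := (K₁ ∪ K₂) ∪ (tsupport (fun x => ε * η x) ∪ tsupport φ) with hKdef
  have hK : IsCompact K := (hK₁.union hK₂).union (hce.2.1.union hφ.2.1)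
  have hKΩ : K ⊆ Ω := Set.union_subset (Set.union_subset hK₁Ω hK₂Ω)
    (Set.union_subset hce.2.2 hφ.2.2)
  have hB := (((hKu.mono (Set.subset_union_left.trans Set.subset_union_left)).sub
    (hKv.mono (Set.subset_union_right.trans Set.subset_union_left))).sub
    (hce.h1Compact hK (Set.subset_union_left.trans Set.subset_union_right))).posPart hK
  have hA := (hφ.h1Compact hK (Set.subset_union_right.trans Set.subset_union_right)).posPart hK
  have hψ := hA.sub ((hA.sub hB).posPart hK)
  have hgc : ∀ x ∈ tsupport φ, gradient (fun x => ε * η x) x = 0 := fun x hx => by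
    rw [gradient_fun_mul (differentiableAt_const _)
      (hη.contDiff_one.differentiable one_ne_zero x), hηg x hx]
    simp
  refine ⟨K, hK, hKΩ, Set.subset_union_right.trans Set.subset_union_right,
    hψ.congr (Eventually.of_forall fun x => ?_)
    (Eventually.of_forall fun x => ?_)⟩
  · by_cases hx : x ∈ tsupport φ
    · simp only [Pi.sub_apply, hη1 x hx, one_mul, mul_one]
      rcases le_total (max (φ x) 0) (max (u x - v x - ε) 0) with h | h
      · rw [min_eq_left h, max_eq_right (sub_nonpos.2 h), sub_zero]
      · rw [min_eq_right h, max_eq_left (sub_nonneg.2 h), sub_sub_cancel]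
    · simp [image_eq_zero_of_notMem_tsupport hx]
  · by_cases hx : x ∈ tsupport φ
    · simp only [minGradient, Pi.sub_apply, Pi.add_apply, Set.indicator_apply, Set.mem_ofPred_eq,
        hη1 x hx, hηg x hx, hgc x hx, one_mul, mul_one, one_smul, smul_zero, add_zero, sub_zero]
      rcases le_or_gt (φ x) 0 with h1 | h1
      · simp [h1, h1.not_gt]
      · rcases le_or_gt (φ x) (max (u x - v x - ε) 0) with h3 | h3
        · simp [h1, h1.le, h3, h3.not_gt]
        · rcases le_or_gt (u x - v x - ε) 0 with h4 | h4
          · simp [h1, h1.le, h4, h4.not_gt, h1.not_ge]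
          · rw [max_eq_left h4.le] at h3
            simp only [max_eq_left h4.le]
            simp [h1, h1.le, h4, h3, h3.not_ge]
    · simp [minGradient, image_eq_zero_of_notMem_tsupport hx]

lemma tendsto_integral_inner_zero {α F : Type*} [MeasurableSpace α] {μ : Measure α}
    [NormedAddCommGroup F] [InnerProductSpace ℝ F] {D g : ℕ → α → F} {G : α → F}
    (hD : ∀ n, AEStronglyMeasurable (D n) μ) (hg : ∀ n, AEStronglyMeasurable (g n) μ)
    (hG : MemLp G 2 μ) (hgG : Tendsto (fun n => eLpNorm (g n - G) 2 μ) atTop (𝓝 0))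
    (hlim : Tendsto (fun n => eLpNorm (D n) 2 μ) atTop (𝓝 0)) :
    Tendsto (fun n => ∫ x, inner ℝ (D n x) (g n x) ∂μ) atTop (𝓝 0) := by
  rw [tendsto_zero_iff_enorm_tendsto_zero]
  have h1 : Tendsto (fun n => eLpNorm (D n) 2 μ * (eLpNorm (g n - G) 2 μ + eLpNorm G 2 μ)) atTop
      (𝓝 (0 * (0 + eLpNorm G 2 μ))) :=
    ENNReal.Tendsto.mul hlim (Or.inr (by simpa using hG.2.ne)) (hgG.add_const _)
      (Or.inr (by simp))
  rw [zero_mul] at h1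
  refine tendsto_of_tendsto_of_tendsto_of_le_of_le tendsto_const_nhds h1 (fun _ => zero_le)
    fun n => ?_
  refine (enorm_integral_le_lintegral_enorm _).trans ?_
  rw [← eLpNorm_one_eq_lintegral_enorm]
  refine (eLpNorm_inner_le (hD n) (hg n)).trans ?_
  gcongr
  calc eLpNorm (g n) 2 μ = eLpNorm (g n - G + G) 2 μ := by rw [sub_add_cancel]
    _ ≤ _ := eLpNorm_add_le ((hg n).sub hG.1) hG.1 (by norm_num)

lemma MemLp.tendsto_indicator_zero {α F : Type*} [MeasurableSpace α] {μ : Measure α}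
    [NormedAddCommGroup F] {D : α → F} (hD : MemLp D 2 μ) {S : ℕ → Set α}
    (hS : ∀ n, NullMeasurableSet (S n) μ) (h : ∀ᵐ x ∂μ, ∀ᶠ n in atTop, x ∈ S n → D x = 0) :
    Tendsto (fun n => eLpNorm ((S n).indicator D) 2 μ) atTop (𝓝 0) := by
  have := tendsto_eLpNorm_two_of_dominated (g := fun _ => (0 : F))
    (fun n => hD.1.indicator₀ (hS n)) aestronglyMeasurable_const hD.norm
    (fun n => Eventually.of_forall fun x => norm_indicator_le_norm_self _ _) ?_
  · refine this.congr fun n => ?_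
    congr 1
    ext1 x
    simp
  · filter_upwards [h] with x hx
    refine tendsto_const_nhds.congr' ?_
    filter_upwards [hx] with n hn
    by_cases hxn : x ∈ S n
    · simp [hxn, hn hxn]
    · simp [hxn]

lemma IsWeakSolution.ae_le_add [Nontrivial (EuclideanSpace ℝ (Fin N))] (hΩ : IsOpen Ω)
    (hΩb : Bornology.IsBounded Ω) (hβ : 0 < β)
    (hf : IntegrableOn f Ω volume) (hf0 : ∀ᵐ x ∂(volume.restrict Ω), 0 ≤ f x)
    (hu : IsWeakSolution β Ω f u Gu) (hv : IsWeakSolution β Ω f v Gv) {ε : ℝ} (hε : 0 < ε)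
    (hu0 : MemH10 Ω fun x => max (u x - ε) 0) :
    ∀ᵐ x ∂(volume.restrict Ω), u x ≤ v x + ε := by
  obtain ⟨G, hGw, hU2, hG2, φ, hφ, hgr, hae⟩ := exists_testFunction_seq hu0
  set μ := (volume : Measure (EuclideanSpace ℝ (Fin N))).restrict Ω with hμ
  set U : EuclideanSpace ℝ (Fin N) → ℝ := fun x => max (u x - ε) 0 with hUdef
  set W : EuclideanSpace ℝ (Fin N) → ℝ := fun x => max (u x - v x - ε) 0 with hWdef
  have hvpos := hv.2.2.ae_pos hΩ
  have hum : AEStronglyMeasurable u μ := hu.1.1.1.aestronglyMeasurable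
  have hvm : AEStronglyMeasurable v μ := hv.1.1.1.aestronglyMeasurable
  have hWm : AEStronglyMeasurable W μ :=
    (((hum.sub hvm).aemeasurable.sub_const ε).max aemeasurable_const).aestronglyMeasurable
  have hφm : ∀ n, AEStronglyMeasurable (φ n) μ := fun n => (hφ n).1.continuous.aestronglyMeasurable
  have hW0 : ∀ x, 0 ≤ W x := fun x => le_max_right _ _
  -- Where `W > 0` one has `W = U - v`, so `v > 0` makes `W < U` strict. This strictness makes the
  -- approximations `φ n` eventually exceed `W`.
  have hWU : ∀ᵐ x ∂μ, 0 < W x → W x < U x ∧ v x < U x ∧ ε < u x := by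
    filter_upwards [hvpos] with x hx hW
    have h1 : 0 < u x - v x - ε := by
      by_contra hc
      simp only [hWdef, max_eq_right (not_lt.1 hc), lt_irrefl] at hW
    have h2 : W x = u x - v x - ε := max_eq_left h1.le
    have h3 : U x = u x - ε := max_eq_left (by linarith)
    rw [h2, h3]
    exact ⟨by linarith, by linarith, by linarith⟩
  have hlt : ∀ᵐ x ∂μ, ∀ᶠ n in atTop, 0 < W x → W x < φ n x := by
    filter_upwards [hWU, hae] with x h1 h2
    by_cases hW : 0 < W x
    · filter_upwards [h2.eventually_const_lt (h1 hW).1] with n hn _ using hn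
    · exact Eventually.of_forall fun n h => absurd h hW
  have hGv2 := hv.memLp_indicator_gradient hΩ hβ hf hf0 hU2.1 hG2 hφ hgr hae
  have hGu2 : MemLp ({x | ε < u x}.indicator Gu) 2 μ :=
    hG2.ae_eq (gradient_posPart_sub_const hΩ hu.1 hGw)
  set D : EuclideanSpace ℝ (Fin N) → EuclideanSpace ℝ (Fin N) :=
    {x | 0 < W x}.indicator (Gu - Gv) with hDdef
  have hWset : NullMeasurableSet {x | 0 < W x} μ :=
    nullMeasurableSet_lt aemeasurable_const hWm.aemeasurable
  -- On `{W > 0}` both `ε < u` and `v < U` hold, so the two truncated gradients already known to be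
  -- in `L²` are the full ones.
  have hD : MemLp D 2 μ := by
    have h1 : MemLp ({x | 0 < W x}.indicator
        ({x | ε < u x}.indicator Gu - {x | v x < U x}.indicator Gv)) 2 μ := by
      have h := hGu2.sub hGv2
      exact h.mono (h.1.indicator₀ hWset)
        (Eventually.of_forall fun x => norm_indicator_le_norm_self _ _)
    refine h1.ae_eq ?_
    filter_upwards [hWU] with x hx
    by_cases hW : 0 < W x
    · obtain ⟨-, h2, h3⟩ := hx hW
      simp [D, hW, h2, h3]
    · simp [D, hW]
  set A : ℕ → Set (EuclideanSpace ℝ (Fin N)) := fun n => {x | 0 < φ n x ∧ φ n x ≤ W x} with hA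
  have hAm : ∀ n, NullMeasurableSet (A n) μ := fun n =>
    (nullMeasurableSet_lt aemeasurable_const (hφm n).aemeasurable).inter
      (nullMeasurableSet_le (hφm n).aemeasurable hWm.aemeasurable)
  have hA0 : ∀ᵐ x ∂μ, ∀ᶠ n in atTop, x ∉ A n := by
    filter_upwards [hlt] with x hx
    filter_upwards [hx] with n hn hxA
    exact absurd (hn (hxA.1.trans_le hxA.2)) hxA.2.not_gt
  set B : ℕ → Set (EuclideanSpace ℝ (Fin N)) := fun n => {x | 0 < W x ∧ W x < φ n x} with hB
  have hBm : ∀ n, NullMeasurableSet (B n) μ := fun n =>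
    hWset.inter (nullMeasurableSet_lt hWm.aemeasurable (hφm n).aemeasurable)
  have hgm : ∀ n, MemLp (gradient (φ n)) 2 μ := fun n =>
    (memLp_gradient_of_tsupport_subset (hφ n).2.1 (hφ n).contDiff_one subset_rfl).restrict Ω
  have hD2 : Integrable (fun x => ‖D x‖ ^ 2) μ := hD.norm.integrable_sq
  -- The test function is `min φₙ⁺ W`: its gradient is `∇φₙ` on `A n` and `∇(u - v)` on `B n`. In
  -- the limit `A n` disappears and `B n` fills `{W > 0}`.
  have htest : ∀ n, ∫ x, inner ℝ ((A n).indicator D x) (gradient (φ n) x) ∂μ +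
      ∫ x, (B n).indicator (fun x => ‖D x‖ ^ 2) x ∂μ ≤ 0 := fun n => by
    obtain ⟨K, hK, hKΩ, hφK, hKH⟩ := h1Compact_min hΩ hu.1 hv.1 (ε := ε) (hφ n)
    have h1 := hu.integral_inner_sub_nonpos hΩ.measurableSet hβ hf hf0 hv hK hKΩ hKH
      (fun x => le_min (le_max_right _ _) (le_max_right _ _)) fun x hx => by
        have h2 : 0 < W x := hx.trans_le (min_le_right _ _)
        by_contra hc
        have h3 : W x = 0 := max_eq_right (by linarith [not_le.1 hc])
        exact h2.ne' h3
    have h2 : ∀ x, inner ℝ (Gu x - Gv x) (minGradient (φ n) W Gu Gv x) =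
        inner ℝ ((A n).indicator D x) (gradient (φ n) x) +
          (B n).indicator (fun x => ‖D x‖ ^ 2) x := fun x => by
      simp only [minGradient, Pi.add_apply, inner_add_right]
      congr 1
      · by_cases hx : x ∈ A n
        · have hW : 0 < W x := hx.1.trans_le hx.2
          rw [Set.indicator_of_mem hx, Set.indicator_of_mem hx, hDdef,
            Set.indicator_of_mem (show x ∈ {x | 0 < W x} from hW), Pi.sub_apply]
        · rw [Set.indicator_of_notMem hx, Set.indicator_of_notMem hx, inner_zero_left,
            inner_zero_right]
      · by_cases hx : x ∈ B n
        · rw [Set.indicator_of_mem hx, Set.indicator_of_mem hx, hDdef,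
            Set.indicator_of_mem (show x ∈ {x | 0 < W x} from hx.1), Pi.sub_apply,
            real_inner_self_eq_norm_sq]
        · rw [Set.indicator_of_notMem hx, Set.indicator_of_notMem hx, inner_zero_right]
    rw [← integral_add (MemLp.integrable_inner_two
      (hD.mono (hD.1.indicator₀ (hAm n))
        (Eventually.of_forall fun x => norm_indicator_le_norm_self _ _)) (hgm n))
      (hD2.indicator₀ (hBm n))]
    simp_rw [← h2]
    refine le_of_eq_of_le (setIntegral_eq_of_subset_of_forall_sdiff_eq_zero hΩ.measurableSet hKΩ
      fun x hx => ?_) h1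
    have h3 : φ n x = 0 := image_eq_zero_of_notMem_tsupport fun hc => hx.2 (hφK hc)
    rw [h2, Set.indicator_of_notMem fun hc => (lt_irrefl _) (h3 ▸ hc.1),
      Set.indicator_of_notMem fun hc => (hc.1.trans (h3 ▸ hc.2)).false, inner_zero_left, add_zero]
  have hAD : Tendsto (fun n => eLpNorm ((A n).indicator D) 2 μ) atTop (𝓝 0) :=
    MemLp.tendsto_indicator_zero hD hAm <| by
      filter_upwards [hA0] with x hx
      filter_upwards [hx] with n hn hxA using absurd hxA hn
  have hlim1 := tendsto_integral_inner_zero (fun n => hD.1.indicator₀ (hAm n))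
    (fun n => (hgm n).1) hG2 hgr hAD
  have hlim2 : Tendsto (fun n => ∫ x, (B n).indicator (fun x => ‖D x‖ ^ 2) x ∂μ) atTop
      (𝓝 (∫ x, ‖D x‖ ^ 2 ∂μ)) := by
    refine tendsto_integral_of_dominated_convergence (fun x => ‖D x‖ ^ 2)
      (fun n => hD2.1.indicator₀ (hBm n)) hD2 (fun n => Eventually.of_forall fun x => ?_) ?_
    · refine (norm_indicator_le_norm_self _ _).trans ?_
      simp
    · filter_upwards [hlt] with x hx
      refine tendsto_const_nhds.congr' ?_
      filter_upwards [hx] with n hn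
      by_cases hW : 0 < W x
      · rw [Set.indicator_of_mem (show x ∈ B n from ⟨hW, hn hW⟩)]
      · rw [Set.indicator_of_notMem fun hc => hW hc.1, hDdef,
          Set.indicator_of_notMem (show x ∉ {x | 0 < W x} from hW)]
        simp
  have hDle : ∫ x, ‖D x‖ ^ 2 ∂μ ≤ 0 := by
    have := le_of_tendsto' (hlim1.add hlim2) htest
    rwa [zero_add] at this
  have hDz : ∀ᵐ x ∂μ, D x = 0 := by
    have h1 := (integral_eq_zero_iff_of_nonneg (fun x => sq_nonneg ‖D x‖) hD2).1
      (le_antisymm hDle (integral_nonneg fun x => sq_nonneg _))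
    filter_upwards [h1] with x hx
    simpa using hx
  obtain ⟨R, hR⟩ := hΩb.subset_closedBall 0
  have hR' : Ω ⊆ Metric.closedBall 0 (max R 0) :=
    hR.trans (Metric.closedBall_subset_closedBall (le_max_left _ _))
  -- Now that `D` vanishes, only the part on `A n` survives in the gradient of the minimum. Poincaré
  -- is applied to these minima, since `W` itself is not known to be an `H¹` limit of compactly
  -- supported functions.
  have hpoin : ∀ n, eLpNorm (fun x => min (max (φ n x) 0) (W x)) 2 μ ≤
      ENNReal.ofReal (2 * max R 0) *
        (eLpNorm (gradient (φ n) - G) 2 μ + eLpNorm ((A n).indicator G) 2 μ) := fun n => by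
    obtain ⟨K, hK, hKΩ, hφK, hKH⟩ := h1Compact_min hΩ hu.1 hv.1 (ε := ε) (hφ n)
    refine (eLpNorm_restrict_le _ _ _ _).trans
      ((hKH.poincare (le_max_right R 0) (hKΩ.trans hR')).trans ?_)
    gcongr
    have hsupp : Function.support (minGradient (φ n) W Gu Gv) ⊆ Ω := fun x hx => by
      by_contra hc
      refine hx ?_
      have h3 : φ n x = 0 :=
        image_eq_zero_of_notMem_tsupport fun hc' => hc ((hφ n).2.2 hc')
      have hxA : x ∉ A n := fun hc => (lt_irrefl _) (h3 ▸ hc.1)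
      have hxB : x ∉ B n := fun hc => (hc.1.trans (h3 ▸ hc.2)).false
      simp only [minGradient, Pi.add_apply]
      rw [Set.indicator_of_notMem hxA, Set.indicator_of_notMem hxB, add_zero]
    rw [← eLpNorm_restrict_eq_of_support_subset hsupp]
    have hae' : minGradient (φ n) W Gu Gv =ᵐ[μ]
        (A n).indicator (gradient (φ n) - G) + (A n).indicator G := by
      filter_upwards [hDz] with x hx
      have hB0 : (B n).indicator (Gu - Gv) x = 0 := by
        by_cases hxB : x ∈ B n
        · rw [hDdef, Set.indicator_of_mem (show x ∈ {x | 0 < W x} from hxB.1)] at hx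
          rw [Set.indicator_of_mem hxB, hx]
        · rw [Set.indicator_of_notMem hxB]
      rw [← Set.indicator_add', sub_add_cancel]
      simp only [minGradient, Pi.add_apply]
      rw [hB0, add_zero]
    rw [eLpNorm_congr_ae hae']
    refine (eLpNorm_add_le (((hgm n).sub hG2).1.indicator₀ (hAm n)) (hG2.1.indicator₀ (hAm n))
      (by norm_num)).trans ?_
    gcongr
    exact eLpNorm_indicator_le _
  have hrhs : Tendsto (fun n => ENNReal.ofReal (2 * max R 0) *
      (eLpNorm (gradient (φ n) - G) 2 μ + eLpNorm ((A n).indicator G) 2 μ)) atTop (𝓝 0) := by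
    have h1 : Tendsto (fun n => eLpNorm ((A n).indicator G) 2 μ) atTop (𝓝 0) :=
      MemLp.tendsto_indicator_zero hG2 hAm <| by
        filter_upwards [hA0] with x hx
        filter_upwards [hx] with n hn hxA using absurd hxA hn
    simpa using ENNReal.Tendsto.const_mul (a := ENNReal.ofReal (2 * max R 0)) (hgr.add h1)
      (Or.inr ENNReal.ofReal_ne_top)
  -- The minima converge to `W` almost everywhere while their norms tend to zero; lower
  -- semicontinuity of the norm suffices.
  have hzero : eLpNorm W 2 μ ≤ 0 := by
    refine (Lp.eLpNorm_lim_le_liminf_eLpNorm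
      (f := fun n x => min (max (φ n x) 0) (W x)) (fun n => ?_) W ?_).trans ?_
    · exact (((hφm n).aemeasurable.max aemeasurable_const).min
        hWm.aemeasurable).aestronglyMeasurable
    · filter_upwards [hlt] with x hx
      refine tendsto_const_nhds.congr' ?_
      filter_upwards [hx] with n hn
      rcases (hW0 x).eq_or_lt with hW | hW
      · rw [← hW, min_eq_right (le_max_right _ _)]
      · rw [min_eq_right ((hn hW).le.trans (le_max_left _ _))]
    · rw [← hrhs.liminf_eq]
      exact liminf_le_liminf (Eventually.of_forall hpoin)
  have hW := (eLpNorm_eq_zero_iff hWm (by norm_num)).1 (le_antisymm hzero zero_le)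
  filter_upwards [hW] with x hx
  have : u x - v x - ε ≤ W x := le_max_left _ _
  rw [hx] at this
  simp only [Pi.zero_apply] at this
  linarith

lemma IsDirichletSolution.ae_le [Nontrivial (EuclideanSpace ℝ (Fin N))] (hΩ : IsOpen Ω)
    (hΩb : Bornology.IsBounded Ω) (hβ : 0 < β)
    (hf : IntegrableOn f Ω volume) (hf0 : ∀ᵐ x ∂(volume.restrict Ω), 0 ≤ f x)
    (hu : IsDirichletSolution β Ω f u) (hv : IsDirichletSolution β Ω f v) :
    ∀ᵐ x ∂(volume.restrict Ω), u x ≤ v x := by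
  obtain ⟨⟨Gu, hu1, hu2⟩, hu3, -, hu4⟩ := hu
  obtain ⟨⟨Gv, hv1, hv2⟩, hv3, -⟩ := hv
  have h : ∀ n : ℕ, ∀ᵐ x ∂(volume.restrict Ω), u x ≤ v x + 1 / ((n : ℝ) + 1) := fun n =>
    IsWeakSolution.ae_le_add hΩ hΩb hβ hf hf0 ⟨hu1, hu2, hu3⟩ ⟨hv1, hv2, hv3⟩
      (by positivity) (hu4 _ (by positivity))
  filter_upwards [ae_all_iff.2 h] with x hx
  have := tendsto_one_div_add_atTop_nhds_zero_nat (𝕜 := ℝ) |>.const_add (v x)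
  rw [add_zero] at this
  exact ge_of_tendsto' this hx

lemma IsDirichletSolution.ae_eq [Nontrivial (EuclideanSpace ℝ (Fin N))] (hΩ : IsOpen Ω)
    (hΩb : Bornology.IsBounded Ω) (hβ : 0 < β)
    (hf : IntegrableOn f Ω volume) (hf0 : ∀ᵐ x ∂(volume.restrict Ω), 0 ≤ f x)
    (hu : IsDirichletSolution β Ω f u) (hv : IsDirichletSolution β Ω f v) :
    ∀ᵐ x ∂(volume.restrict Ω), v x = u x := by
  filter_upwards [hu.ae_le hΩ hΩb hβ hf hf0 hv, hv.ae_le hΩ hΩb hβ hf hf0 hu] with x h1 h2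
  exact le_antisymm h2 h1

end Comparison

/-! ### Invariance of the Dirichlet problem under rigid motions. -/

section RigidMotion

variable {N : ℕ} {Ω : Set (EuclideanSpace ℝ (Fin N))} {β : ℝ}
  {f u w : EuclideanSpace ℝ (Fin N) → ℝ}
  {G : EuclideanSpace ℝ (Fin N) → EuclideanSpace ℝ (Fin N)}

/-- The rigid motion `x ↦ A x + b`. -/
noncomputable def rigidMotion {E : Type*} [NormedAddCommGroup E] [InnerProductSpace ℝ E]
    (A : E ≃ₗᵢ[ℝ] E) (b : E) : E ≃ₜ E :=
  A.toHomeomorph.trans (Homeomorph.addRight b)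

lemma rigidMotion_apply {E : Type*} [NormedAddCommGroup E] [InnerProductSpace ℝ E]
    (A : E ≃ₗᵢ[ℝ] E) (b x : E) : rigidMotion A b x = A x + b := rfl

lemma rigidMotion_symm_apply {E : Type*} [NormedAddCommGroup E] [InnerProductSpace ℝ E]
    (A : E ≃ₗᵢ[ℝ] E) (b x : E) : (rigidMotion A b).symm x = A.symm (x - b) := by
  rw [Homeomorph.symm_apply_eq, rigidMotion_apply]
  simp

variable (A : EuclideanSpace ℝ (Fin N) ≃ₗᵢ[ℝ] EuclideanSpace ℝ (Fin N))
  (b : EuclideanSpace ℝ (Fin N))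

lemma contDiff_rigidMotion {n : WithTop ℕ∞} : ContDiff ℝ n (rigidMotion A b) :=
  A.contDiff.add contDiff_const

lemma contDiff_rigidMotion_symm {n : WithTop ℕ∞} : ContDiff ℝ n (rigidMotion A b).symm := by
  have : ContDiff ℝ n fun x => A.symm (x - b) :=
    A.symm.contDiff.comp (contDiff_id.sub contDiff_const)
  convert this using 1
  ext1 x
  exact rigidMotion_symm_apply A b x

lemma measurableEmbedding_rigidMotion : MeasurableEmbedding (rigidMotion A b) :=
  (rigidMotion A b).measurableEmbedding

lemma measurePreserving_rigidMotion :
    MeasurePreserving (rigidMotion A b) (volume : Measure (EuclideanSpace ℝ (Fin N))) volume :=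
  (measurePreserving_add_right volume b).comp A.measurePreserving

lemma measurePreserving_rigidMotion_restrict (hΩ : rigidMotion A b '' Ω = Ω) :
    MeasurePreserving (rigidMotion A b) (volume.restrict Ω) (volume.restrict Ω) := by
  have := (measurePreserving_rigidMotion A b).restrict_image_emb
    (measurableEmbedding_rigidMotion A b) Ω
  rwa [hΩ] at this

/-- The adjoint of an isometry is its inverse. -/
lemma gradient_comp_rigidMotion {φ : EuclideanSpace ℝ (Fin N) → ℝ} (hφ : Differentiable ℝ φ)
    (x : EuclideanSpace ℝ (Fin N)) :
    gradient (φ ∘ rigidMotion A b) x = A.symm (gradient φ (rigidMotion A b x)) := by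
  refine ext_inner_right ℝ fun v => ?_
  have h1 : HasFDerivAt (rigidMotion A b)
      (A.toContinuousLinearEquiv : EuclideanSpace ℝ (Fin N) →L[ℝ] EuclideanSpace ℝ (Fin N)) x :=
    A.toContinuousLinearEquiv.hasFDerivAt.add_const b
  rw [A.symm.inner_map_eq_flip, inner_gradient_left, inner_gradient_left,
    ((hφ _).hasFDerivAt.comp x h1).fderiv]
  rfl

variable {A b}

lemma IsTestFunction.comp_homeomorph {k : ℕ∞}
    {σ : EuclideanSpace ℝ (Fin N) ≃ₜ EuclideanSpace ℝ (Fin N)}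
    (hσ : ContDiff ℝ (k : WithTop ℕ∞) σ) (hΩ : σ '' Ω = Ω) {φ : EuclideanSpace ℝ (Fin N) → ℝ}
    (hφ : IsTestFunction k Ω φ) : IsTestFunction k Ω (φ ∘ σ) := by
  refine ⟨hφ.1.comp hσ, hφ.2.1.comp_homeomorph σ, ?_⟩
  rw [tsupport_comp_eq_preimage]
  intro x hx
  have h1 : σ x ∈ σ '' Ω := hΩ.symm ▸ hφ.2.2 hx
  exact (Function.Injective.mem_set_image σ.injective).1 h1

lemma IsTestFunction.exists_comp {k : ℕ∞} (hΩ : rigidMotion A b '' Ω = Ω)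
    {φ : EuclideanSpace ℝ (Fin N) → ℝ} (hφ : IsTestFunction k Ω φ) :
    ∃ ψ, IsTestFunction k Ω ψ ∧ φ = ψ ∘ rigidMotion A b := by
  refine ⟨φ ∘ (rigidMotion A b).symm, hφ.comp_homeomorph (contDiff_rigidMotion_symm A b) ?_, ?_⟩
  · conv_lhs => rw [← hΩ]
    rw [← Set.image_comp]
    simp
  · ext1 x
    simp

lemma image_subset_of_subset (hΩ : rigidMotion A b '' Ω = Ω)
    {K : Set (EuclideanSpace ℝ (Fin N))} (hK : K ⊆ Ω) : rigidMotion A b '' K ⊆ Ω :=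
  (Set.image_mono hK).trans hΩ.subset

lemma locallyIntegrableOn_comp_rigidMotion {F : Type*} [NormedAddCommGroup F] (hΩo : IsOpen Ω)
    (hΩ : rigidMotion A b '' Ω = Ω) {g : EuclideanSpace ℝ (Fin N) → F}
    (hg : LocallyIntegrableOn g Ω volume) :
    LocallyIntegrableOn (g ∘ rigidMotion A b) Ω volume := by
  rw [locallyIntegrableOn_iff hΩo.isLocallyClosed] at hg ⊢
  intro K hKΩ hK
  exact ((measurePreserving_rigidMotion A b).integrableOn_image
    (measurableEmbedding_rigidMotion A b)).1
    (hg _ (image_subset_of_subset hΩ hKΩ) (hK.image (rigidMotion A b).continuous))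

lemma memLp_symm_comp {μ : Measure (EuclideanSpace ℝ (Fin N))}
    {g : EuclideanSpace ℝ (Fin N) → EuclideanSpace ℝ (Fin N)} (hg : MemLp g 2 μ) :
    MemLp (fun x => A.symm (g x)) 2 μ :=
  hg.mono (A.symm.continuous.comp_aestronglyMeasurable hg.1)
    (Eventually.of_forall fun x => by simp)

lemma MemL2Loc.comp_rigidMotion {F : Type*} [NormedAddCommGroup F]
    (hΩ : rigidMotion A b '' Ω = Ω) {g : EuclideanSpace ℝ (Fin N) → F} (hg : MemL2Loc Ω g) :
    MemL2Loc Ω (g ∘ rigidMotion A b) := fun K hK hKΩ =>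
  (hg _ (hK.image (rigidMotion A b).continuous)
    (image_subset_of_subset hΩ hKΩ)).comp_measurePreserving
    ((measurePreserving_rigidMotion A b).restrict_image_emb
      (measurableEmbedding_rigidMotion A b) K)

lemma HasWeakGradient.comp_rigidMotion (hΩo : IsOpen Ω) (hΩ : rigidMotion A b '' Ω = Ω)
    (h : HasWeakGradient Ω w G) :
    HasWeakGradient Ω (w ∘ rigidMotion A b) (fun x => A.symm (G (rigidMotion A b x))) := by
  refine ⟨locallyIntegrableOn_comp_rigidMotion hΩo hΩ h.1, ?_, fun φ hφ i => ?_⟩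
  · intro x hx
    obtain ⟨s, hs, hi⟩ := locallyIntegrableOn_comp_rigidMotion hΩo hΩ h.2.1 x hx
    refine ⟨s, hs, Integrable.mono hi (A.symm.continuous.comp_aestronglyMeasurable hi.1)
      (Eventually.of_forall fun x => ?_)⟩
    rw [LinearIsometryEquiv.norm_map]
    rfl
  · obtain ⟨ψ, hψ, rfl⟩ := hφ.exists_comp hΩ
    have hd : Differentiable ℝ ψ := hψ.contDiff_one.differentiable one_ne_zero
    -- The `i`-th coordinate of `A⁻¹ y` is the inner product of `y` with `A eᵢ`, so a coordinate
    -- direction becomes a general one.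
    have key := h.integral_mul_inner_gradient hψ (A (EuclideanSpace.single i 1))
    have hcoord : ∀ y : EuclideanSpace ℝ (Fin N),
        A.symm y i = inner ℝ y (A (EuclideanSpace.single i 1)) := fun y => by
      rw [← A.symm_apply_apply (EuclideanSpace.single i 1), ← A.symm.inner_map_map,
        LinearIsometryEquiv.apply_symm_apply, A.symm_apply_apply, EuclideanSpace.inner_single_right]
      simp
    have e1 := (measurePreserving_rigidMotion A b).integral_comp
      (measurableEmbedding_rigidMotion A b)
      (fun x => w x * inner ℝ (gradient ψ x) (A (EuclideanSpace.single i 1)))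
    have e2 := (measurePreserving_rigidMotion A b).integral_comp
      (measurableEmbedding_rigidMotion A b)
      (fun x => inner ℝ (G x) (A (EuclideanSpace.single i 1)) * ψ x)
    rw [setIntegral_eq_integral_of_forall_compl_eq_zero,
      setIntegral_eq_integral_of_forall_compl_eq_zero]
    · simp only [gradient_comp_rigidMotion A b hd, hcoord, Function.comp_apply]
      rw [e1, e2, key]
    · intro x hx
      rw [image_eq_zero_of_notMem_tsupport fun hc => hx (hφ.2.2 hc), mul_zero]
    · intro x hx
      simp [gradient_eq_zero_of_notMem_tsupport fun hc => hx (hφ.2.2 hc)]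

lemma MemH10.comp_rigidMotion (hΩo : IsOpen Ω) (hΩ : rigidMotion A b '' Ω = Ω)
    (h : MemH10 Ω w) : MemH10 Ω (w ∘ rigidMotion A b) := by
  obtain ⟨G, h1, h2, h3, φ, h4, h5, h6⟩ := h
  have hmp := measurePreserving_rigidMotion_restrict A b hΩ
  refine ⟨_, h1.comp_rigidMotion hΩo hΩ, h2.comp_measurePreserving hmp,
    memLp_symm_comp (h3.comp_measurePreserving hmp), fun n => φ n ∘ rigidMotion A b,
    fun n => (h4 n).comp_homeomorph (contDiff_rigidMotion A b) hΩ, h5.congr fun n => ?_,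
    h6.congr fun n => ?_⟩
  · exact (eLpNorm_comp_measurePreserving
      ((h4 n).1.continuous.aestronglyMeasurable.sub h2.1) hmp).symm
  · refine (eLpNorm_comp_measurePreserving
      ((h4 n).contDiff_one.continuous_gradient.aestronglyMeasurable.sub h3.1) hmp).symm.trans ?_
    refine eLpNorm_congr_norm_ae (Eventually.of_forall fun x => ?_)
    rw [gradient_comp_rigidMotion A b ((h4 n).contDiff_one.differentiable one_ne_zero), ← map_sub,
      LinearIsometryEquiv.norm_map]
    rfl

/-- Every test function is the pullback of one by the motion, inner products of gradients are
unchanged by the isometry, and the motion preserves volume. -/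
lemma IsDirichletSolution.comp_rigidMotion (hΩo : IsOpen Ω) (hΩ : rigidMotion A b '' Ω = Ω)
    (hu : IsDirichletSolution β Ω f u) :
    IsDirichletSolution β Ω (f ∘ rigidMotion A b) (u ∘ rigidMotion A b) := by
  obtain ⟨⟨G, ⟨g1, g2, g3⟩, heq⟩, hpos, h0, hH⟩ := hu
  have hmp := measurePreserving_rigidMotion_restrict A b hΩ
  refine ⟨⟨_, ⟨g1.comp_rigidMotion hΩo hΩ, g2.comp_rigidMotion hΩ, fun K hK hKΩ =>
    memLp_symm_comp (g3.comp_rigidMotion hΩ K hK hKΩ)⟩, fun φ hφ => ?_⟩, fun K hK hKΩ => ?_,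
    hmp.quasiMeasurePreserving.ae h0, fun ε hε => (hH ε hε).comp_rigidMotion hΩo hΩ⟩
  · obtain ⟨ψ, hψ, rfl⟩ := hφ.exists_comp hΩ
    have hd : Differentiable ℝ ψ := hψ.1.differentiable (by simp)
    have e1 := hmp.integral_comp (measurableEmbedding_rigidMotion A b)
      (fun x => inner ℝ (G x) (gradient ψ x))
    have e2 := hmp.integral_comp (measurableEmbedding_rigidMotion A b)
      (fun x => f x / u x ^ β * ψ x)
    simp only [gradient_comp_rigidMotion A b hd, LinearIsometryEquiv.inner_map_map,
      Function.comp_apply]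
    rw [e1, e2, heq ψ hψ]
  · obtain ⟨c, hc, h⟩ := hpos _ (hK.image (rigidMotion A b).continuous)
      (image_subset_of_subset hΩ hKΩ)
    exact ⟨c, hc, ((measurePreserving_rigidMotion A b).restrict_image_emb
      (measurableEmbedding_rigidMotion A b) K).quasiMeasurePreserving.ae h⟩

lemma IsDirichletSolution.congr_right_hand_side {f' : EuclideanSpace ℝ (Fin N) → ℝ}
    (hu : IsDirichletSolution β Ω f u) (hff' : ∀ᵐ x ∂(volume.restrict Ω), f x = f' x) :
    IsDirichletSolution β Ω f' u := by
  obtain ⟨⟨G, hG, heq⟩, h⟩ := hu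
  refine ⟨⟨G, hG, fun φ hφ => (heq φ hφ).trans (integral_congr_ae ?_)⟩, h⟩
  filter_upwards [hff'] with x hx
  rw [hx]

lemma IsDirichletSolution.funSymmetric [Nontrivial (EuclideanSpace ℝ (Fin N))] (hΩo : IsOpen Ω)
    (hΩb : Bornology.IsBounded Ω) (hβ : 0 < β)
    (hf : IntegrableOn f Ω volume) (hf0 : ∀ᵐ x ∂(volume.restrict Ω), 0 ≤ f x)
    (hu : IsDirichletSolution β Ω f u)
    (hΩ : SetSymmetric (rigidMotion A b) Ω) (hfσ : FunSymmetric (rigidMotion A b) Ω f) :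
    FunSymmetric (rigidMotion A b) Ω u :=
  hu.ae_eq hΩo hΩb hβ hf hf0 ((hu.comp_rigidMotion hΩo hΩ).congr_right_hand_side hfσ)

end RigidMotion

/-! ### Reflections as rigid motions. -/

section Reflection

variable {N : ℕ}

lemma hyperplaneReflection_eq_rigidMotion {ν : EuclideanSpace ℝ (Fin N)} (hν : ‖ν‖ = 1) (c : ℝ) :
    hyperplaneReflection ν c =
      rigidMotion (Submodule.span ℝ {ν})ᗮ.reflection ((2 * c) • ν) := by
  ext1 x
  rw [hyperplaneReflection, rigidMotion_apply, Submodule.reflection_orthogonal_apply,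
    Submodule.reflection_singleton_apply, hν, real_inner_comm]
  simp only [neg_sub]
  simp only [Real.ringHom_apply, one_pow, div_one, two_smul]
  module

lemma flipFirst_eq_hyperplaneReflection [NeZero N] :
    (flipFirst : EuclideanSpace ℝ (Fin N) → EuclideanSpace ℝ (Fin N)) =
      hyperplaneReflection (EuclideanSpace.single 0 1) 0 := by
  ext x i
  by_cases hi : i = 0
  · subst hi
    simp [flipFirst, hyperplaneReflection, EuclideanSpace.inner_single_right]
    ring
  · simp [flipFirst, hyperplaneReflection, hi]

end Reflection

/-! ### From invariance under isometries to radial functions. -/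

section Radial

variable {E : Type*} [NormedAddCommGroup E] [InnerProductSpace ℝ E] [FiniteDimensional ℝ E]
  [MeasurableSpace E] [BorelSpace E]

/-- A locally integrable function which is almost everywhere invariant under each linear isometry
coincides almost everywhere with a function of the norm. -/
lemma exists_radial_of_forall_isometry [Nontrivial E] {w : E → ℝ} (hw : LocallyIntegrable w volume)
    (h : ∀ A : E ≃ₗᵢ[ℝ] E, ∀ᵐ x, w (A x) = w x) : ∃ g : ℝ → ℝ, ∀ᵐ x, w x = g ‖x‖ := by
  obtain ⟨e, he⟩ := exists_norm_eq E (c := 1) zero_le_one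
  set m : ℕ → E → ℝ := fun n x => ⨍ y in Metric.closedBall x (1 / ((n : ℝ) + 1)), w y with hm
  have hinv : ∀ n (A : E ≃ₗᵢ[ℝ] E) x, m n (A x) = m n x := fun n A x => by
    have hemb := A.toHomeomorph.measurableEmbedding
    simp only [hm, setAverage_eq]
    rw [← A.image_closedBall, A.measurePreserving.setIntegral_image_emb hemb,
      measureReal_def, measureReal_def]
    congr 1
    · rw [A.image_closedBall, Measure.addHaar_closedBall_center,
        Measure.addHaar_closedBall_center volume x]
    · exact integral_congr_ae (ae_restrict_of_ae (h A))
  -- Two points of equal norm are exchanged by the reflection in the hyperplane orthogonal to their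
  -- difference.
  have hrad : ∀ n x y, ‖x‖ = ‖y‖ → m n x = m n y := fun n x y hxy => by
    rw [← hinv n (Submodule.span ℝ {x - y})ᗮ.reflection x, Submodule.reflection_sub hxy]
  -- By Lebesgue differentiation the limit exists and equals `w x` with `r = ‖x‖` for almost every
  -- `x`; other values of `r` do not matter.
  refine ⟨fun r => limUnder atTop fun n => m n (r • e), ?_⟩
  filter_upwards [(Besicovitch.vitaliFamily (volume : Measure E)).ae_tendsto_average hw] with x hx
  have ht : Tendsto (fun n : ℕ => 1 / ((n : ℝ) + 1)) atTop (𝓝[>] 0) :=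
    tendsto_nhdsWithin_iff.2 ⟨tendsto_one_div_add_atTop_nhds_zero_nat,
      Eventually.of_forall fun n => by simp only [Set.mem_Ioi]; positivity⟩
  have h1 : Tendsto (fun n => m n x) atTop (𝓝 (w x)) :=
    hx.comp ((Besicovitch.tendsto_filterAt volume x).comp ht)
  have h2 : ∀ n, m n x = m n (‖x‖ • e) := fun n => hrad n _ _ (by simp [norm_smul, he])
  simp_rw [h2] at h1
  exact h1.limUnder_eq.symm

end Radial

/-! ### The main theorem. -/

theorem theorem2p3 {N : ℕ} [NeZero N] {β : ℝ} (hβ : 0 < β)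
    {Ω : Set (EuclideanSpace ℝ (Fin N))} (hΩ : IsOpen Ω) (hΩb : Bornology.IsBounded Ω)
    {f : EuclideanSpace ℝ (Fin N) → ℝ} (hf : IntegrableOn f Ω volume)
    (hf0 : ∀ᵐ x ∂(volume.restrict Ω), 0 ≤ f x)
    {u : EuclideanSpace ℝ (Fin N) → ℝ} (hu : IsDirichletSolution β Ω f u) :
    (∀ v : EuclideanSpace ℝ (Fin N) → ℝ, IsDirichletSolution β Ω f v →
      ∀ᵐ x ∂(volume.restrict Ω), v x = u x) ∧
    (∀ (ν : EuclideanSpace ℝ (Fin N)) (c : ℝ), ‖ν‖ = 1 →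
      SetSymmetric (hyperplaneReflection ν c) Ω → FunSymmetric (hyperplaneReflection ν c) Ω f →
      FunSymmetric (hyperplaneReflection ν c) Ω u) ∧
    (SetSymmetric flipFirst Ω → FunSymmetric flipFirst Ω f → FunSymmetric flipFirst Ω u) ∧
    (IsBallOrAnnulus Ω → RadialOn Ω f → RadialOn Ω u) := by
  have hrefl : ∀ (ν : EuclideanSpace ℝ (Fin N)) (c : ℝ), ‖ν‖ = 1 →
      SetSymmetric (hyperplaneReflection ν c) Ω → FunSymmetric (hyperplaneReflection ν c) Ω f →
      FunSymmetric (hyperplaneReflection ν c) Ω u := fun ν c hν => by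
    rw [hyperplaneReflection_eq_rigidMotion hν]
    exact hu.funSymmetric hΩ hΩb hβ hf hf0
  refine ⟨fun v hv => hu.ae_eq hΩ hΩb hβ hf hf0 hv, hrefl, ?_, fun hball hfrad => ?_⟩
  · rw [flipFirst_eq_hyperplaneReflection]
    exact hrefl _ _ (by simp)
  · have hinv : ∀ A : EuclideanSpace ℝ (Fin N) ≃ₗᵢ[ℝ] EuclideanSpace ℝ (Fin N),
        ∀ x, A x ∈ Ω ↔ x ∈ Ω := fun A x => by
      rcases hball with ⟨R, -, rfl⟩ | ⟨r, R, -, -, rfl⟩ <;> simp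
    have hrot : ∀ A : EuclideanSpace ℝ (Fin N) ≃ₗᵢ[ℝ] EuclideanSpace ℝ (Fin N),
        ∀ᵐ x ∂(volume.restrict Ω), u (A x) = u x := fun A => by
      have hset : rigidMotion A 0 '' Ω = Ω := by
        ext x
        rw [(rigidMotion A 0).image_eq_preimage_symm, Set.mem_preimage, rigidMotion_symm_apply,
          sub_zero, hinv]
      obtain ⟨g, hg⟩ := hfrad
      have := hu.funSymmetric hΩ hΩb hβ hf hf0 (A := A) (b := 0) hset (by
        have h1 := (measurePreserving_rigidMotion_restrict A 0 hset).quasiMeasurePreserving.ae hg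
        filter_upwards [hg, h1] with x h2 h3
        rw [h2, h3, rigidMotion_apply, add_zero, LinearIsometryEquiv.norm_map])
      filter_upwards [this] with x hx
      simpa [rigidMotion_apply] using hx
    -- Although `u` is only in `H¹_loc`, the boundary condition puts `(u - 1)⁺` in `L²(Ω)`, and `0 ≤
    -- u ≤ (u - 1)⁺ + 1` on a set of finite measure.
    have hint : IntegrableOn u Ω volume := by
      have hfin : IsFiniteMeasure (volume.restrict Ω) :=
        ⟨by simpa using hΩb.measure_lt_top⟩
      obtain ⟨⟨G, hG, -⟩, -, hu0, hu1⟩ := hu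
      obtain ⟨-, -, hL2, -⟩ := hu1 1 one_pos
      have h1 : Integrable (fun x => max (u x - 1) 0 + 1) (volume.restrict Ω) :=
        (hL2.integrable (by norm_num)).add (integrable_const 1)
      refine Integrable.mono' h1 hG.1.1.aestronglyMeasurable ?_
      filter_upwards [hu0] with x hx
      rw [Real.norm_of_nonneg hx]
      linarith [le_max_left (u x - 1) 0]
    -- Extension by zero preserves the invariance because `Ω` is invariant under every linear
    -- isometry.
    obtain ⟨g, hg⟩ := exists_radial_of_forall_isometry
      (w := Ω.indicator u) ((integrable_indicator_iff hΩ.measurableSet).2 hint).locallyIntegrable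
      fun A => by
        filter_upwards [(ae_restrict_iff' hΩ.measurableSet).1 (hrot A)] with x hx
        by_cases hxΩ : x ∈ Ω
        · rw [Set.indicator_of_mem hxΩ, Set.indicator_of_mem ((hinv A x).2 hxΩ), hx hxΩ]
        · rw [Set.indicator_of_notMem hxΩ, Set.indicator_of_notMem (mt (hinv A x).1 hxΩ)]
    refine ⟨g, ?_⟩
    rw [ae_restrict_iff' hΩ.measurableSet]
    filter_upwards [hg] with x hx hxΩ
    rwa [Set.indicator_of_mem hxΩ] at hx
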